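/- Let $n\ge 1$ and let $\lambda=(\lambda_1>\lambda_2>\dots>\lambda_{n-1}>\lambda_n=0)$ be a partition (a regular dominant weight of type $A_{n-1}$). Let $q,t$ be elements of a field with $t\neq 0$ and $q^at^b\ne 1$ for all integers $a,b\ge 1$ (for instance, independent indeterminates over $\mathbb{Q}$). **Fillings.** Identify $\lambda$ with the set of cells $\{(i,j): 1\le i\le n,\ 1\le j\le\lambda_i\}$, let $\lambda'_j=|\{i:\lambda_i\ge j\}|$, and put $n(\lambda)=\sum_i(i-1)\lambda_i$. For a cell $u=(i,j)$ let $\mathrm{arm}(u)=\lambda_i-j$ and $\mathrm{leg}(u)=\lambda'_j-i$. Two cells attack each other if they are distinct cells $(i,j),(k,j)$ of one column, or are of the form $(i,j),(k,j-1)$ with $i<k$. A filling $\sigma:\lambda\to[n]$ is nonattacking if $\sigma(u)\neq\sigma(v)$ whenever $u,v$ attack each other. Let $\mathrm{Des}(\sigma)$ (respectively $\mathrm{Diff}(\sigma)$) be the set of cells $(i,j)$ with $(i,j+1)\in\lambda$ and $\sigma(i,j)>\sigma(i,j+1)$ (respectively $\sigma(i,j)\ne\sigma(i,j+1)$). In the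 reading order, $(i,j)$ precedes $(i',j')$ if $j<j'$, or $j=j'$ and $i<i'$. Let $\mathrm{Inv}(\sigma)$ be the set of pairs $(u,v)$ of attacking cells with $u$ preceding $v$ and $\sigma(u)>\sigma(v)$. Put $\mathrm{maj}(\sigma)=\sum_{u\in\mathrm{Des}(\sigma)}\mathrm{arm}(u)$ and $\mathrm{inv}(\sigma)=|\mathrm{Inv}(\sigma)|-\sum_{u\in\mathrm{Des}(\sigma)}\mathrm{leg}(u)$. Let $\mathrm{content}(\sigma)=(c_1,\dots,c_n)$ with $c_a=|\sigma^{-1}(a)|$. **The chain of roots.** Let $\Gamma(k)$ be the sequence of pairs $(i,l)$, $1\le i\le k<l\le n$, ordered by decreasing $i$ and, for equal $i$, by decreasing $l$; let $\Gamma'(k)$ be $\Gamma(k)$ with all pairs $(i,k+1)$ removed. Let $\Gamma=\Gamma_{\lambda_1}\Gamma_{\lambda_1-1}\cdots\Gamma_2=(\beta_1,\dots,\beta_m)$, where $\Gamma_j=\Gamma'(\lambda'_j)$ if $j$ is the smallest column index with column height $\lambda'_j$, and $\Gamma_j=\Gamma(\lambda'_j)$ otherwise. A pair $(i,k)$ stands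 for the root $\varepsilon_i-\varepsilon_k$ and for the transposition of $i$ and $k$ in $S_n$. Let $l_p=|\{p'\le p:\beta_{p'}=\beta_p\}|$. For $\alpha=\varepsilon_i-\varepsilon_k$ and $c\in\mathbb Z$ let $H_{\alpha,c}=\{v\in\mathbb{R}^n: v_i-v_k=c\}$ and $s_{\alpha,c}(v)=v-(v_i-v_k-c)\alpha$; put $\widehat r_p=s_{\beta_p,l_p}$. **Folding pairs.** A folding pair $(w,T)$ consists of $w\in S_n$ and a subsequence $T$ of $\Gamma$, given by a set of positions $J=\{j_1<\dots<j_s\}$; write $|T|=s$, let $T_j$ be the part of $T$ in $\Gamma_j$, and let $wT$ (and likewise $wT_{\lambda_1}\cdots T_{j+1}$) denote $w$ multiplied on the right by the transpositions in $T$, from left to right. Let $\mu(T)=\widehat r_{j_1}\cdots\widehat r_{j_s}(\lambda)\in\mathbb{Z}^n$, and let $S_n$ act on vectors by $w(\varepsilon_i)=\varepsilon_{w(i)}$. The filling $f(w,T)$ is defined by $f(w,T)(i,j)=\pi_j(i)$, where $\pi_j=wT_{\lambda_1}T_{\lambda_1-1}\cdots T_{j+1}$. Let $A_0=\{v: 0<v_i-v_k<1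 \text{ for all } i<k\}$ and $A_p=\widehat r_p(A_{p-1})$. For $p\in J$ put $g=w\,\widehat r_{j_1}\cdots\widehat r_{j_h}$, where $j_1<\dots<j_h$ are the elements of $J$ smaller than $p$; the position $p$ is a positive folding if the alcove $g(A_{p-1})$ lies on the positive side $\{v: v_a-v_b>c\}$ of the hyperplane $g(H_{\beta_p,l_p})=H_{\varepsilon_a-\varepsilon_b,\,c}$, $a<b$, and a negative folding otherwise. Let $T_j^+$ and $T_j^-$ be the parts of $T_j$ in the positive and negative folding positions. Let $\ell$ be the length function (number of inversions) on $S_n$. **Theorem.** For every nonattacking filling $\sigma:\lambda\to[n]$, the fibre $f^{-1}(\sigma)$ is nonempty, and $x^{w(\mu(T))}=x^{\mathrm{content}(\sigma)}$ for all $(w,T)\in f^{-1}(\sigma)$. Furthermore, $$\sum_{(w,T)\in f^{-1}(\sigma)} t^{\frac12(\ell(w)-\ell(wT)-|T|)}(1-t)^{|T|}\Bigg(\prod_{j,\,(i,k)\in T_j^+}\frac{1}{1-q^{\mathrm{arm}(i,j-1)}t^{k-i}}\Bigg)\Bigg(\prod_{j,\,(i,k)\in T_j^-}\frac{q^{\mathrm{arm}(i,j-1)}t^{k-i}}{1-q^{\mathrm{arm}(i,j-1)}t^{k-i}}\Bigg)$$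 $$=t^{\,n(\lambda)-\mathrm{inv}(\sigma)}\,q^{\mathrm{maj}(\sigma)}\prod_{u\in\mathrm{Diff}(\sigma)}\frac{1-t}{1-q^{\mathrm{arm}(u)}t^{\mathrm{leg}(u)+1}}.$$ -/

import Mathlib

namespace RamYip

/-! Positions `1, …, n` are modelled by `Fin n`, so row `i` of a diagram is the element of `Fin n`
with value `i - 1`. Columns are numbered by natural numbers starting from `1`. -/

/-- A partition `λ₁ ≥ … ≥ λₙ` given by its parts is a regular dominant weight of type `A_{n-1}`:
`λ₁ > λ₂ > … > λₙ = 0`. -/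
def IsRegular {n : ℕ} (lam : Fin n → ℕ) : Prop :=
  StrictAnti lam ∧ ∀ i : Fin n, i.val + 1 = n → lam i = 0

/-- The largest part `λ₁`, i.e. the number of columns. -/
def numCols {n : ℕ} (lam : Fin n → ℕ) : ℕ :=
  Finset.univ.sup lam

/-- The Young diagram of `λ`: the cells `(i, j)` with `1 ≤ j ≤ λᵢ`. -/
def diagram {n : ℕ} (lam : Fin n → ℕ) : Finset (Fin n × ℕ) :=
  (Finset.univ ×ˢ Finset.Icc 1 (numCols lam)).filter fun u => u.2 ≤ lam u.1

/-- The part `λ'ⱼ` of the conjugate partition, i.e. the height of column `j ≥ 1`. -/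
def conj {n : ℕ} (lam : Fin n → ℕ) (j : ℕ) : ℕ :=
  (Finset.univ.filter fun i : Fin n => j ≤ lam i).card

/-- `n(λ) = ∑ (i - 1) λᵢ`. -/
def nStat {n : ℕ} (lam : Fin n → ℕ) : ℕ :=
  ∑ i : Fin n, i.val * lam i

/-- The number of cells strictly to the left of `u` in its row (columns are numbered from right
to left, so these are the cells with a larger column number). -/
def arm {n : ℕ} (lam : Fin n → ℕ) (u : Fin n × ℕ) : ℕ :=
  ((diagram lam).filter fun v => v.1 = u.1 ∧ u.2 < v.2).card

/-- The number of cells strictly below `u` in its column. -/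
def leg {n : ℕ} (lam : Fin n → ℕ) (u : Fin n × ℕ) : ℕ :=
  ((diagram lam).filter fun v => v.2 = u.2 ∧ u.1 < v.1).card

/-! ### Fillings and their statistics -/

/-- A filling of the diagram of `λ` with entries in `{1, …, n}`. -/
abbrev Filling {n : ℕ} (lam : Fin n → ℕ) : Type :=
  {u : Fin n × ℕ // u ∈ diagram lam} → Fin n

/-- Two cells attack each other if they are distinct cells of one column, or lie in consecutive
columns with the cell in the left column strictly above the one in the right column. -/
def Attack {n : ℕ} (u v : Fin n × ℕ) : Prop :=
  (u.2 = v.2 ∧ u.1 ≠ v.1) ∨ (u.2 = v.2 + 1 ∧ u.1 < v.1) ∨ (v.2 = u.2 + 1 ∧ v.1 < u.1)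

/-- The reading order: columns from right to left, each column from top to bottom. -/
def Precedes {n : ℕ} (u v : Fin n × ℕ) : Prop :=
  u.2 < v.2 ∨ (u.2 = v.2 ∧ u.1 < v.1)

def Nonattacking {n : ℕ} {lam : Fin n → ℕ} (σ : Filling lam) : Prop :=
  ∀ u v, Attack u.1 v.1 → σ u ≠ σ v

open Classical in
/-- `Des(σ)`: the cells `(i, j)` with `(i, j + 1)` in the diagram and `σ(i, j) > σ(i, j + 1)`. -/
noncomputable def Des {n : ℕ} {lam : Fin n → ℕ} (σ : Filling lam) :
    Finset {u : Fin n × ℕ // u ∈ diagram lam} :=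
  Finset.univ.filter fun u => ∃ v, v.1 = (u.1.1, u.1.2 + 1) ∧ σ v < σ u

open Classical in
/-- `Diff(σ)`: the cells `(i, j)` with `(i, j + 1)` in the diagram and `σ(i, j) ≠ σ(i, j + 1)`. -/
noncomputable def Diff {n : ℕ} {lam : Fin n → ℕ} (σ : Filling lam) :
    Finset {u : Fin n × ℕ // u ∈ diagram lam} :=
  Finset.univ.filter fun u => ∃ v, v.1 = (u.1.1, u.1.2 + 1) ∧ σ u ≠ σ v

open Classical in
/-- The set of inversions of `σ`. -/
noncomputable def Inv {n : ℕ} {lam : Fin n → ℕ} (σ : Filling lam) :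
    Finset ({u : Fin n × ℕ // u ∈ diagram lam} × {u : Fin n × ℕ // u ∈ diagram lam}) :=
  Finset.univ.filter fun p =>
    Attack p.1.1 p.2.1 ∧ Precedes p.1.1 p.2.1 ∧ σ p.2 < σ p.1

noncomputable def maj {n : ℕ} {lam : Fin n → ℕ} (σ : Filling lam) : ℕ :=
  ∑ u ∈ Des σ, arm lam u.1

noncomputable def inv {n : ℕ} {lam : Fin n → ℕ} (σ : Filling lam) : ℤ :=
  ((Inv σ).card : ℤ) - ∑ u ∈ Des σ, (leg lam u.1 : ℤ)

/-- The content of a filling, as an exponent vector in `ℤⁿ`. -/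
def content {n : ℕ} {lam : Fin n → ℕ} (σ : Filling lam) : Fin n → ℤ :=
  fun a => ((Finset.univ.filter fun u => σ u = a).card : ℤ)

/-! ### The `λ`-chain -/

/-- An entry of the chain `Γ`: the positive root `ε_lo - ε_hi` together with the index `col` of the
segment `Γ_col` in which it occurs. -/
structure Entry (n : ℕ) where
  col : ℕ
  lo : Fin n
  hi : Fin n

/-- The rows `i = k, k - 1, …, 1` in this order, where row `i` consists of the pairs
`(i, n), (i, n - 1), …, (i, r + 1)` in this order. -/
def rootRows (n k r : ℕ) : List (Fin n × Fin n) :=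
  ((List.finRange n).reverse.filter fun i => i.val < k).flatMap fun i =>
    ((List.finRange n).reverse.filter fun h => r ≤ h.val).map fun h => (i, h)

/-- `Γ(k)`. -/
def gamma (n k : ℕ) : List (Fin n × Fin n) := rootRows n k k

/-- `Γ'(k)`, obtained from `Γ(k)` by removing the pair `(i, k + 1)` at the end of each row. -/
def gamma' (n k : ℕ) : List (Fin n × Fin n) := rootRows n k (k + 1)

/-- The segment `Γⱼ`: it is `Γ'(λ'ⱼ)` if `j` is the smallest column index with column height `λ'ⱼ`,
and `Γ(λ'ⱼ)` otherwise. -/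
def segment {n : ℕ} (lam : Fin n → ℕ) (j : ℕ) : List (Fin n × Fin n) :=
  if ∀ i < j, 1 ≤ i → conj lam i ≠ conj lam j then gamma' n (conj lam j)
  else gamma n (conj lam j)

/-- The `λ`-chain `Γ = Γ_{λ₁} ⋯ Γ₂`. -/
def chain {n : ℕ} (lam : Fin n → ℕ) : List (Entry n) :=
  (List.range' 2 (numCols lam - 1)).reverse.flatMap fun j =>
    (segment lam j).map fun β => ⟨j, β.1, β.2⟩

/-- The positions `1, …, m` in the `λ`-chain. -/
abbrev Pos {n : ℕ} (lam : Fin n → ℕ) : Type := Fin (chain lam).length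

/-- The entry `β_p` of `Γ`. -/
def entry {n : ℕ} (lam : Fin n → ℕ) (p : Pos lam) : Entry n := (chain lam).get p

/-- `l_p`, the number of positions `p' ≤ p` carrying the same root as position `p`. -/
def level {n : ℕ} (lam : Fin n → ℕ) (p : Pos lam) : ℕ :=
  (Finset.univ.filter fun p' : Pos lam => p' ≤ p ∧
    (entry lam p').lo = (entry lam p).lo ∧ (entry lam p').hi = (entry lam p).hi).card

/-- The reflection `r_p`, a transposition in `Sₙ`. -/
def refl {n : ℕ} (lam : Fin n → ℕ) (p : Pos lam) : Equiv.Perm (Fin n) :=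
  Equiv.swap (entry lam p).lo (entry lam p).hi

/-- The affine reflection `s_{α,l}`, `α = ε_a - ε_b`, on `Rⁿ`: `v ↦ v - (⟨v, α^∨⟩ - l) α`. -/
def affineRefl {n : ℕ} {R : Type*} [CommRing R] (a b : Fin n) (l : ℤ) (v : Fin n → R) :
    Fin n → R :=
  v - (v a - v b - (l : R)) • (Pi.single a 1 - Pi.single b 1)

/-- The product `r̂_{p₁} ⋯ r̂_{pₛ}` of the affine reflections `r̂_p = s_{β_p, l_p}`, applied to `v`. -/
def affineWord {n : ℕ} (lam : Fin n → ℕ) {R : Type*} [CommRing R] (L : List (Pos lam))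
    (v : Fin n → R) : Fin n → R :=
  L.foldr (fun p x => affineRefl (entry lam p).lo (entry lam p).hi (level lam p) x) v

/-- The action of `Sₙ` on vectors by permuting coordinates, `w(ε_i) = ε_{w(i)}`. -/
def permAct {n : ℕ} {R : Type*} (w : Equiv.Perm (Fin n)) (v : Fin n → R) : Fin n → R :=
  fun a => v (w⁻¹ a)

/-! ### Folding pairs -/

/-- The elements of `J`, in increasing order. -/
def sorted {n : ℕ} {lam : Fin n → ℕ} (J : Finset (Pos lam)) : List (Pos lam) :=
  (List.finRange (chain lam).length).filter fun p => p ∈ J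

/-- The Weyl group element `φ(J) = r_{j₁} ⋯ r_{jₛ}`. -/
def phi {n : ℕ} {lam : Fin n → ℕ} (J : Finset (Pos lam)) : Equiv.Perm (Fin n) :=
  ((sorted J).map (refl lam)).prod

/-- The weight `μ(J) = r̂_{j₁} ⋯ r̂_{jₛ}(λ)`. -/
def mu {n : ℕ} {lam : Fin n → ℕ} (J : Finset (Pos lam)) : Fin n → ℤ :=
  affineWord lam (sorted J) fun i => (lam i : ℤ)

/-- The permutation `π_j(w, T) = w T_{λ₁} T_{λ₁ - 1} ⋯ T_{j+1}`. -/
def piPerm {n : ℕ} {lam : Fin n → ℕ} (w : Equiv.Perm (Fin n)) (J : Finset (Pos lam)) (j : ℕ) :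
    Equiv.Perm (Fin n) :=
  w * phi (J.filter fun p => j < (entry lam p).col)

/-- The filling map `f`, `f(w, T)(i, j) = π_j(i)`. -/
def fillingMap {n : ℕ} (lam : Fin n → ℕ) (w : Equiv.Perm (Fin n)) (J : Finset (Pos lam)) :
    Filling lam :=
  fun u => piPerm w J u.1.2 u.1.1

/-- The length of a permutation: its number of inversions. -/
def permLength {n : ℕ} (w : Equiv.Perm (Fin n)) : ℕ :=
  (Finset.univ.filter fun p : Fin n × Fin n => p.1 < p.2 ∧ w p.2 < w p.1).card

/-! ### Positive and negative foldings

Subsets of `V = ℝⁿ / ℝ(1, …, 1)` are represented by their preimages in `ℝⁿ`. -/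

/-- The hyperplane `H_{α,c}` for `α = ε_a - ε_b`. -/
def hyperplane {n : ℕ} (a b : Fin n) (c : ℤ) : Set (Fin n → ℝ) :=
  {v | v a - v b = c}

/-- The fundamental alcove. -/
def fundamentalAlcove (n : ℕ) : Set (Fin n → ℝ) :=
  {v | ∀ a b : Fin n, a < b → 0 < v a - v b ∧ v a - v b < 1}

/-- The alcove `A_{p-1}` of the alcove path `Π`, i.e. the one from which the path crosses the `p`-th
wall. As `r̂_i` is the reflection in the common wall of `A_{i-1}` and `A_i`, it is the image of the
fundamental alcove under `r̂_{p-1} ⋯ r̂_1`. -/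
def alcoveBefore {n : ℕ} (lam : Fin n → ℕ) (p : Pos lam) : Set (Fin n → ℝ) :=
  affineWord lam (sorted (Finset.univ.filter fun p' => p' < p)).reverse '' fundamentalAlcove n

/-- The affine map `w r̂_{j₁} ⋯ r̂_{jᵢ}`, where `j₁ < ⋯ < jᵢ` are the elements of `J` before `p`. The
foldings at these positions carry the alcove `w(A_{p-1})` and the `p`-th wall of `w(Π)` to the
corresponding alcove and wall of the alcove walk encoded by `(w, J)`; foldings at positions `≥ p`
leave both unchanged. -/
def foldedMap {n : ℕ} {lam : Fin n → ℕ} (w : Equiv.Perm (Fin n)) (J : Finset (Pos lam))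
    (p : Pos lam) (v : Fin n → ℝ) : Fin n → ℝ :=
  permAct w (affineWord lam (sorted (J.filter fun p' => p' < p)) v)

/-- `p` is a positive folding position of the alcove walk of `(w, J)` (for `p ∈ J`): the alcove of
the walk at position `p` lies on the positive side `⟨v, α^∨⟩ > c` of the hyperplane `H_{α,c}`,
`α` a positive root, which contains the `p`-th face of the walk. -/
def IsPositiveFolding {n : ℕ} {lam : Fin n → ℕ} (w : Equiv.Perm (Fin n)) (J : Finset (Pos lam))
    (p : Pos lam) : Prop :=
  ∃ (a b : Fin n) (c : ℤ), a < b ∧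
    foldedMap w J p '' hyperplane (entry lam p).lo (entry lam p).hi (level lam p)
      = hyperplane a b c ∧
    foldedMap w J p '' alcoveBefore lam p ⊆ {v | (c : ℝ) < v a - v b}

open Classical in
/-- `J⁺`, the set of positive foldings. -/
noncomputable def Jpos {n : ℕ} {lam : Fin n → ℕ} (w : Equiv.Perm (Fin n)) (J : Finset (Pos lam)) :
    Finset (Pos lam) :=
  J.filter fun p => IsPositiveFolding w J p

open Classical in
/-- `J⁻`, the set of negative foldings. -/
noncomputable def Jneg {n : ℕ} {lam : Fin n → ℕ} (w : Equiv.Perm (Fin n)) (J : Finset (Pos lam)) :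
    Finset (Pos lam) :=
  J.filter fun p => ¬ IsPositiveFolding w J p

/-- The factor `q^{arm(i, j-1)} t^{k-i}` attached to a pair `(i, k)` in the segment `Γⱼ`. -/
def qtFactor {n : ℕ} (lam : Fin n → ℕ) {K : Type*} [Field K] (q t : K) (p : Pos lam) : K :=
  q ^ arm lam ((entry lam p).lo, (entry lam p).col - 1) *
    t ^ ((entry lam p).hi.val - (entry lam p).lo.val)

/-- The coefficient of the folding pair `(w, T)` in the type `A` Ram–Yip formula. The exponent
`(ℓ(w) - ℓ(wT) - |T|) / 2` is an integer, since every factor of `T` is a transposition and so changes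
the parity of the length. -/
noncomputable def weight {n : ℕ} {lam : Fin n → ℕ} {K : Type*} [Field K] (q t : K)
    (w : Equiv.Perm (Fin n)) (J : Finset (Pos lam)) : K :=
  t ^ (((permLength w : ℤ) - (permLength (w * phi J) : ℤ) - (J.card : ℤ)) / 2) *
    (1 - t) ^ J.card *
    (∏ p ∈ Jpos w J, 1 / (1 - qtFactor lam q t p)) *
    (∏ p ∈ Jneg w J, qtFactor lam q t p / (1 - qtFactor lam q t p))

/-- The fibre `f⁻¹(σ)` of the filling map, a set of folding pairs. -/
def fibre {n : ℕ} {lam : Fin n → ℕ} (σ : Filling lam) :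
    Finset (Equiv.Perm (Fin n) × Finset (Pos lam)) :=
  Finset.univ.filter fun P => fillingMap lam P.1 P.2 = σ

end RamYip

/-!
A folding pair `(w, J)` is a walk in `S_n` that starts at `w` and, at each root `(i, l)` of the chain
in turn, either stays or multiplies on the right by the transposition of `i` and `l`. The lengths of
the permutations visited telescope, and a folding is positive or negative according to the order of
the two values it exchanges, so the weight of the pair is a product of coefficients attached to the
single foldings.

On the cycle `1, …, n` the coefficient of a folding records which values lie on the arc between the
two exchanged ones, and arcs compose. Hence the sum over all foldings that share the row `i` and the
segment `Γ_{j + 1}` collapses to one factor, which depends only on `σ(i, j)`, `σ(i, j + 1)` and the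
entries of column `j` below the cell `(i, j)`; that `σ` is nonattacking guarantees that the values
met on the way are the right ones. The sum over the fibre is therefore a product over the cells
`(i, j)` with `(i, j + 1)` in the diagram. Comparing arcs with inversions and descents on the triples
`(i, j)`, `(i, j + 1)`, `(m, j)` with `i < m` identifies the resulting power of `t`.
-/

namespace RamYip

variable {n : ℕ} {lam : Fin n → ℕ}

/-! ### Columns, arms and legs -/

/-- The rows strictly below row `i` among the first `l` rows. With `l` the height of the column of a
cell in row `i` these are the rows counted by its leg, and with `l` the value of a row they are the
rows strictly between `i` and `l`. -/
def rowsBetween (i : Fin n) (l : ℕ) : Finset (Fin n) :=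
  Finset.univ.filter fun m => i < m ∧ m.val < l

theorem mem_rowsBetween {i m : Fin n} {l : ℕ} : m ∈ rowsBetween i l ↔ i < m ∧ m.val < l := by
  simp [rowsBetween]

theorem card_rowsBetween (i : Fin n) {l : ℕ} (hl : l ≤ n) :
    (rowsBetween i l).card = l - (i.val + 1) := by
  have himage : (rowsBetween i l).map Fin.valEmbedding = Finset.Ico (i.val + 1) l := by
    ext m
    simp only [Finset.mem_map, mem_rowsBetween, Fin.valEmbedding_apply, Finset.mem_Ico]
    exact ⟨by rintro ⟨m, hm, rfl⟩; exact hm, fun hm => ⟨⟨m, by omega⟩, hm, rfl⟩⟩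
  rw [← Nat.card_Ico, ← himage, Finset.card_map]

theorem le_numCols (lam : Fin n → ℕ) (i : Fin n) : lam i ≤ numCols lam :=
  Finset.le_sup (f := lam) (Finset.mem_univ i)

theorem mem_diagram {u : Fin n × ℕ} : u ∈ diagram lam ↔ 1 ≤ u.2 ∧ u.2 ≤ lam u.1 := by
  have := le_numCols lam u.1
  simp only [diagram, Finset.mem_filter, Finset.mem_product, Finset.mem_univ, Finset.mem_Icc,
    true_and]
  omega

theorem lt_conj_iff (h : Antitone lam) {i : Fin n} {j : ℕ} :
    i.val < conj lam j ↔ j ≤ lam i := by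
  constructor
  · contrapose!
    intro hj
    rw [← Fin.card_Iio]
    refine Finset.card_le_card fun m hm => ?_
    simp only [Finset.mem_filter, Finset.mem_univ, true_and] at hm
    exact Finset.mem_Iio.mpr (not_le.mp fun him => (hm.trans (h him)).not_gt hj)
  · intro hj
    rw [← Nat.succ_le_iff, Nat.succ_eq_add_one, ← Fin.card_Iic]
    refine Finset.card_le_card fun m hm => ?_
    simp only [Finset.mem_filter, Finset.mem_univ, true_and]
    exact hj.trans (h (Finset.mem_Iic.mp hm))

theorem conj_le_iff (h : Antitone lam) {i : Fin n} {j : ℕ} : conj lam j ≤ i.val ↔ lam i < j := by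
  rw [← not_lt, lt_conj_iff h, not_le]

theorem conj_le (lam : Fin n → ℕ) (j : ℕ) : conj lam j ≤ n :=
  (Finset.card_le_univ _).trans_eq (Fintype.card_fin n)

theorem conj_anti (lam : Fin n → ℕ) : Antitone (conj lam) := fun _ _ hj =>
  Finset.card_le_card (Finset.monotone_filter_right _ fun _ _ hm => hj.trans hm)

theorem conj_le_conj_succ (h : StrictAnti lam) (j : ℕ) : conj lam j ≤ conj lam (j + 1) + 1 := by
  by_contra! hlt
  have hn := conj_le lam j
  set i : Fin n := ⟨conj lam (j + 1), by omega⟩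
  set i' : Fin n := ⟨conj lam (j + 1) + 1, by omega⟩
  have hi : lam i < j + 1 := (conj_le_iff h.antitone).1 le_rfl
  have hi' : j ≤ lam i' := (lt_conj_iff h.antitone).1 hlt
  have : lam i' < lam i := h (Nat.lt_succ_self _)
  omega

theorem arm_eq (lam : Fin n → ℕ) (i : Fin n) (j : ℕ) : arm lam (i, j) = lam i - j := by
  have hcells : ((diagram lam).filter fun v => v.1 = i ∧ j < v.2) =
      (Finset.Ioc j (lam i)).map ⟨Prod.mk i, Prod.mk_right_injective i⟩ := by
    ext ⟨a, b⟩
    simp only [Finset.mem_filter, mem_diagram, Finset.mem_map, Finset.mem_Ioc,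
      Function.Embedding.coeFn_mk, Prod.mk.injEq]
    constructor
    · rintro ⟨hb, rfl, hj⟩
      exact ⟨b, ⟨hj, hb.2⟩, rfl, rfl⟩
    · rintro ⟨_, hb, rfl, rfl⟩
      exact ⟨⟨by omega, hb.2⟩, rfl, hb.1⟩
  rw [arm, hcells, Finset.card_map, Nat.card_Ioc]

theorem leg_eq (h : Antitone lam) (i : Fin n) {j : ℕ} (hj : 1 ≤ j) :
    leg lam (i, j) = (rowsBetween i (conj lam j)).card := by
  have hcells : ((diagram lam).filter fun v => v.2 = j ∧ i < v.1) =
      (rowsBetween i (conj lam j)).map ⟨fun m => (m, j), Prod.mk_left_injective j⟩ := by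
    ext ⟨a, b⟩
    simp only [Finset.mem_filter, mem_diagram, Finset.mem_map, mem_rowsBetween, lt_conj_iff h,
      Function.Embedding.coeFn_mk, Prod.mk.injEq]
    constructor
    · rintro ⟨ha, rfl, hi⟩
      exact ⟨a, ⟨hi, ha.2⟩, rfl, rfl⟩
    · rintro ⟨_, ha, rfl, rfl⟩
      exact ⟨⟨hj, ha.2⟩, rfl, ha.1⟩
  rw [leg, hcells, Finset.card_map]

/-! ### The chain of roots -/

theorem segment_eq (h : StrictAnti lam) {j : ℕ} (hj : 2 ≤ j) :
    segment lam j = rootRows n (conj lam j) (conj lam (j - 1)) := by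
  have hstep := conj_le_conj_succ h (j - 1)
  rw [Nat.sub_add_cancel (by omega : 1 ≤ j)] at hstep
  have hanti := conj_anti lam (by omega : j - 1 ≤ j)
  unfold segment
  split_ifs with hfirst
  · have := hfirst (j - 1) (by omega) (by omega)
    rw [gamma', show conj lam j + 1 = conj lam (j - 1) by omega]
  · push Not at hfirst
    obtain ⟨i, hij, -, hi⟩ := hfirst
    have := conj_anti lam (by omega : i ≤ j - 1)
    rw [gamma, show conj lam (j - 1) = conj lam j by omega]

theorem mem_rootRows {k r : ℕ} {β : Fin n × Fin n} :
    β ∈ rootRows n k r ↔ β.1.val < k ∧ r ≤ β.2.val := by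
  obtain ⟨a, b⟩ := β
  simp [rootRows]

theorem mem_chain (h : StrictAnti lam) {e : Entry n} :
    e ∈ chain lam ↔ 2 ≤ e.col ∧ e.col ≤ lam e.lo ∧ lam e.hi + 2 ≤ e.col := by
  obtain ⟨j, i, l⟩ := e
  have hN := le_numCols lam i
  simp only [chain, List.mem_flatMap, List.mem_reverse, List.mem_range'_1, List.mem_map]
  constructor
  · rintro ⟨j', hj', β, hβ, he⟩
    rw [segment_eq h hj'.1, mem_rootRows, lt_conj_iff h.antitone, conj_le_iff h.antitone] at hβ
    obtain ⟨rfl, rfl, rfl⟩ := Entry.mk.inj he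
    omega
  · rintro ⟨hj, hi, hl⟩
    refine ⟨j, by omega, (i, l), ?_, rfl⟩
    rw [segment_eq h hj, mem_rootRows, lt_conj_iff h.antitone, conj_le_iff h.antitone]
    exact ⟨hi, show lam l < j - 1 by omega⟩

theorem entry_bounds (h : StrictAnti lam) (p : Pos lam) : 2 ≤ (entry lam p).col ∧
    (entry lam p).col ≤ lam (entry lam p).lo ∧ lam (entry lam p).hi + 2 ≤ (entry lam p).col :=
  (mem_chain h).1 (List.get_mem _ p)

theorem lo_lt_hi (h : StrictAnti lam) (p : Pos lam) : (entry lam p).lo < (entry lam p).hi := by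
  have := entry_bounds h p
  rw [← h.lt_iff_gt]
  omega

/-- The order in which roots occur within one segment of the chain. -/
def RootBefore (β β' : Fin n × Fin n) : Prop :=
  β'.1 < β.1 ∨ (β'.1 = β.1 ∧ β'.2 < β.2)

/-- The order in which entries occur in the chain. -/
def EntryBefore (e e' : Entry n) : Prop :=
  e'.col < e.col ∨ (e'.col = e.col ∧ RootBefore (e.lo, e.hi) (e'.lo, e'.hi))

theorem pairwise_rootRows (n k r : ℕ) : (rootRows n k r).Pairwise RootBefore := by
  have hrev : (List.finRange n).reverse.Pairwise fun a b => b < a :=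
    List.pairwise_reverse.mpr (List.pairwise_lt_finRange n)
  rw [rootRows, List.pairwise_flatMap]
  refine ⟨fun i _ => List.pairwise_map.mpr ((hrev.filter _).imp fun hab => Or.inr ⟨rfl, hab⟩),
    (hrev.filter _).imp fun hab x hx y hy => ?_⟩
  obtain ⟨_, _, rfl⟩ := List.mem_map.mp hx
  obtain ⟨_, _, rfl⟩ := List.mem_map.mp hy
  exact Or.inl hab

theorem pairwise_chain (lam : Fin n → ℕ) : (chain lam).Pairwise EntryBefore := by
  have hsegment : ∀ j, (segment lam j).Pairwise RootBefore := by
    intro j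
    unfold segment gamma gamma'
    split_ifs <;> exact pairwise_rootRows _ _ _
  rw [chain, List.pairwise_flatMap, List.pairwise_reverse]
  refine ⟨fun j _ => List.pairwise_map.mpr ((hsegment j).imp fun hab => Or.inr ⟨rfl, hab⟩),
    (List.pairwise_lt_range' (s := 2)).imp fun hab x hx y hy => ?_⟩
  obtain ⟨_, _, rfl⟩ := List.mem_map.mp hx
  obtain ⟨_, _, rfl⟩ := List.mem_map.mp hy
  exact Or.inl hab

theorem entry_before_iff (lam : Fin n → ℕ) {p p' : Pos lam} :
    EntryBefore (entry lam p) (entry lam p') ↔ p < p' := by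
  have hsorted := List.pairwise_iff_get.mp (pairwise_chain lam)
  refine ⟨fun hb => ?_, hsorted p p'⟩
  by_contra! hle
  obtain hlt | rfl := hle.lt_or_eq
  · have hb' : EntryBefore (entry lam p') (entry lam p) := hsorted _ _ hlt
    simp only [EntryBefore, RootBefore] at hb hb'
    omega
  · simp [EntryBefore, RootBefore] at hb

theorem pos_ext {p p' : Pos lam} (hcol : (entry lam p).col = (entry lam p').col)
    (hlo : (entry lam p).lo = (entry lam p').lo) (hhi : (entry lam p).hi = (entry lam p').hi) :
    p = p' := by
  by_contra hne
  rcases lt_or_gt_of_ne hne with hlt | hlt <;>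
    simpa [hcol, hlo, hhi, EntryBefore, RootBefore] using (entry_before_iff lam).2 hlt

theorem col_le_of_lt (lam : Fin n → ℕ) {p p' : Pos lam} (hlt : p < p') :
    (entry lam p').col ≤ (entry lam p).col :=
  ((entry_before_iff lam).2 hlt).elim le_of_lt fun h => h.1.le

/-- The number of the first `k` positions of the chain that carry the root `ε_a - ε_b`. -/
def rootCount (lam : Fin n → ℕ) (k : ℕ) (a b : Fin n) : ℕ :=
  (Finset.univ.filter fun p : Pos lam =>
    p.val < k ∧ (entry lam p).lo = a ∧ (entry lam p).hi = b).card

theorem rootCount_succ (lam : Fin n → ℕ) (p : Pos lam) (a b : Fin n) :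
    rootCount lam (p.val + 1) a b = rootCount lam p.val a b +
      if (entry lam p).lo = a ∧ (entry lam p).hi = b then 1 else 0 := by
  have hsplit : (Finset.univ.filter fun p' : Pos lam =>
      p'.val < p.val + 1 ∧ (entry lam p').lo = a ∧ (entry lam p').hi = b) =
      (Finset.univ.filter fun p' : Pos lam =>
        p'.val < p.val ∧ (entry lam p').lo = a ∧ (entry lam p').hi = b) ∪
      ({p} : Finset (Pos lam)).filter fun p' => (entry lam p').lo = a ∧ (entry lam p').hi = b := by
    ext p'
    simp only [Finset.mem_filter, Finset.mem_univ, true_and, Finset.mem_union,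
      Finset.mem_singleton, ← or_and_right, Nat.lt_succ_iff_lt_or_eq, Fin.ext_iff]
  rw [rootCount, hsplit, Finset.card_union_of_disjoint, Finset.filter_singleton, apply_ite
    Finset.card, Finset.card_singleton, Finset.card_empty, rootCount]
  refine Finset.disjoint_left.mpr fun p' hp' hp => ?_
  simp only [Finset.mem_filter, Finset.mem_singleton] at hp hp'
  exact hp'.2.1.ne (congrArg Fin.val hp.1)

open Classical in
theorem rootCount_eq_card (h : StrictAnti lam) (p : Pos lam) (a b : Fin n) :
    rootCount lam p.val a b = ((Finset.Icc (lam b + 2) (lam a)).filter fun j =>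
      EntryBefore ⟨j, a, b⟩ (entry lam p)).card := by
  refine Finset.card_bij (fun p' _ => (entry lam p').col) (fun p' hp' => ?_)
    (fun p₁ h₁ p₂ h₂ hcol => ?_) fun j hj => ?_
  · obtain ⟨-, hlt, rfl, rfl⟩ := Finset.mem_filter.mp hp'
    obtain ⟨-, hlo, hhi⟩ := entry_bounds h p'
    exact Finset.mem_filter.mpr ⟨Finset.mem_Icc.mpr ⟨hhi, hlo⟩, (entry_before_iff lam).2 hlt⟩
  · obtain ⟨-, -, rfl, rfl⟩ := Finset.mem_filter.mp h₁
    obtain ⟨-, -, hlo, hhi⟩ := Finset.mem_filter.mp h₂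
    exact pos_ext hcol hlo.symm hhi.symm
  · obtain ⟨hj, hbefore⟩ := Finset.mem_filter.mp hj
    rw [Finset.mem_Icc] at hj
    obtain ⟨p', hp' : entry lam p' = _⟩ := List.mem_iff_get.mp ((mem_chain h).2
      (show 2 ≤ (Entry.mk j a b).col ∧ j ≤ lam a ∧ lam b + 2 ≤ j from
        ⟨le_add_self.trans hj.1, hj.2, hj.1⟩))
    rw [← hp', entry_before_iff] at hbefore
    exact ⟨p', by simpa [hp'] using hbefore, by rw [hp']⟩

open Classical in
theorem rootCount_eq (h : StrictAnti lam) (p : Pos lam) (a b : Fin n) :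
    rootCount lam p.val a b = lam a + 1 - max (lam b + 2) ((entry lam p).col +
      if RootBefore (a, b) ((entry lam p).lo, (entry lam p).hi) then 0 else 1) := by
  rw [rootCount_eq_card h, ← Nat.card_Icc]
  congr 1
  ext j
  rw [Finset.mem_filter]
  simp only [Finset.mem_Icc, EntryBefore]
  split_ifs with hroot <;> simp only [hroot, and_true, and_false, or_false] <;> omega

theorem level_eq_rootCount (lam : Fin n → ℕ) (p : Pos lam) :
    level lam p = rootCount lam p.val (entry lam p).lo (entry lam p).hi + 1 := by
  have hsucc := rootCount_succ lam p (entry lam p).lo (entry lam p).hi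
  rw [if_pos ⟨rfl, rfl⟩] at hsucc
  rw [← hsucc, level, rootCount]
  simp only [Fin.le_def, Nat.lt_succ_iff]

theorem level_eq (h : StrictAnti lam) (p : Pos lam) :
    level lam p = lam (entry lam p).lo - (entry lam p).col + 1 := by
  classical
  obtain ⟨-, -, hhi⟩ := entry_bounds h p
  rw [level_eq_rootCount, rootCount_eq h, if_neg (by simp [RootBefore])]
  omega

/-! ### Alcoves -/

theorem mem_sorted {J : Finset (Pos lam)} {p : Pos lam} : p ∈ sorted J ↔ p ∈ J := by
  simp [sorted]

theorem pairwise_sorted (J : Finset (Pos lam)) : (sorted J).Pairwise (· < ·) :=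
  (List.pairwise_lt_finRange _).filter _

theorem sorted_eq_of_mem_iff {J : Finset (Pos lam)} {ps : List (Pos lam)}
    (hps : ps.Pairwise (· < ·)) (hmem : ∀ p, p ∈ ps ↔ p ∈ J) : sorted J = ps :=
  (pairwise_sorted J).eq_of_mem_iff hps fun p => mem_sorted.trans (hmem p).symm

theorem sorted_filter (J : Finset (Pos lam)) (P : Pos lam → Prop) [DecidablePred P] :
    sorted (J.filter P) = (sorted J).filter (fun p => P p) :=
  sorted_eq_of_mem_iff ((pairwise_sorted J).filter _) fun p => by simp [mem_sorted]

theorem sorted_filter_lt_succ (p : Pos lam) :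
    sorted (Finset.univ.filter fun p' : Pos lam => p'.val < p.val + 1) =
      sorted (Finset.univ.filter fun p' : Pos lam => p'.val < p.val) ++ [p] := by
  refine sorted_eq_of_mem_iff (List.pairwise_append.mpr
    ⟨pairwise_sorted _, List.pairwise_singleton _ _, fun a ha b hb => ?_⟩) fun p' => ?_
  · rw [List.mem_singleton.mp hb]
    exact (Finset.mem_filter.mp (mem_sorted.mp ha)).2
  · simp [mem_sorted, le_iff_lt_or_eq, Fin.ext_iff]

theorem affineRefl_apply {R : Type*} [CommRing R] {a b : Fin n} (hab : a ≠ b) (c : ℤ)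
    (v : Fin n → R) (x : Fin n) :
    affineRefl a b c v x = v (Equiv.swap a b x) +
      (c : R) * ((if x = a then 1 else 0) - (if x = b then 1 else 0)) := by
  simp only [affineRefl, Pi.sub_apply, Pi.smul_apply, smul_eq_mul, Pi.single_apply]
  rcases eq_or_ne x a with rfl | hxa
  · simp only [if_true, if_neg hab, Equiv.swap_apply_left]
    ring
  rcases eq_or_ne x b with rfl | hxb
  · simp only [if_true, if_neg hxa, Equiv.swap_apply_right]
    ring
  · simp only [if_neg hxa, if_neg hxb, Equiv.swap_apply_of_ne_of_ne hxa hxb]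
    ring

theorem exists_affineWord_apply (h : StrictAnti lam) {R : Type*} [CommRing R]
    (L : List (Pos lam)) :
    ∃ κ : Fin n → ℤ, ∀ (v : Fin n → R) (x : Fin n),
      affineWord lam L v x = v ((L.map (refl lam)).prod⁻¹ x) + κ x := by
  induction L with
  | nil => exact ⟨0, by simp [affineWord]⟩
  | cons p L ih =>
    obtain ⟨κ, hκ⟩ := ih
    refine ⟨fun x => κ (refl lam p x) + (level lam p : ℤ) *
      ((if x = (entry lam p).lo then 1 else 0) - (if x = (entry lam p).hi then 1 else 0)),
      fun v x => ?_⟩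
    change affineRefl (entry lam p).lo (entry lam p).hi (level lam p) (affineWord lam L v) x = _
    rw [affineRefl_apply (lo_lt_hi h p).ne, hκ]
    simp only [List.map_cons, List.prod_cons, mul_inv_rev, Equiv.Perm.mul_apply, refl,
      Equiv.swap_inv]
    push_cast
    ring

/-- The set of points whose coordinate differences `v a - v b` exceed `c a b`. If
`c b a = -1 - c a b`, this is the intersection of the open strips between the hyperplanes
`H_{ε_a - ε_b, c a b}` and `H_{ε_a - ε_b, c a b + 1}`, the form in which alcoves are described. -/
def strips (c : Fin n → Fin n → ℤ) : Set (Fin n → ℝ) :=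
  {v | ∀ a b, a ≠ b → (c a b : ℝ) < v a - v b}

/-- Reflecting an alcove in its wall `H_{ε_i - ε_l, c i l + 1}` only moves it across that wall:
the hypothesis `hwall` says that no other hyperplane separates the alcove from its image. -/
theorem affineRefl_mem_strips {c : Fin n → Fin n → ℤ} {i l : Fin n} (hil : i ≠ l)
    (hanti : ∀ a b, a ≠ b → c b a = -1 - c a b)
    (hwall : ∀ m, m ≠ i → m ≠ l → c i m = c i l + 1 + c l m) {v : Fin n → ℝ}
    (hv : v ∈ strips c) :
    affineRefl i l (c i l + 1) v ∈ strips fun a b =>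
      c a b + (if i = a ∧ l = b then 1 else 0) - (if i = b ∧ l = a then 1 else 0) := by
  set x := affineRefl i l (c i l + 1) v with hx
  have hxi : x i = v l + (c i l + 1) := by simp [hx, affineRefl_apply hil, hil]
  have hxl : x l = v i - (c i l + 1) := by
    rw [hx, affineRefl_apply hil, if_neg hil.symm, if_pos rfl, Equiv.swap_apply_right]
    push_cast
    ring
  have hxm : ∀ m, m ≠ i → m ≠ l → x m = v m := fun m hi hl => by
    simp [hx, affineRefl_apply hil, hi, hl, Equiv.swap_apply_of_ne_of_ne hi hl]
  have hanti' : ∀ a b, a ≠ b → (c b a : ℝ) = -1 - c a b := fun a b hab => by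
    exact_mod_cast hanti a b hab
  have hwall' : ∀ m, m ≠ i → m ≠ l → (c i m : ℝ) = c i l + 1 + c l m := fun m hi hl => by
    exact_mod_cast hwall m hi hl
  intro a b hab
  have hvab := hv a b hab
  push_cast
  rcases eq_or_ne a i with rfl | hai
  · rcases eq_or_ne b l with rfl | hbl
    · grind [hv b a hab.symm]
    · grind [hv l b hbl.symm]
  rcases eq_or_ne a l with rfl | hal
  · rcases eq_or_ne b i with rfl | hbi
    · grind [hv b a hab.symm]
    · grind [hv i b hbi.symm]
  rcases eq_or_ne b i with rfl | hbi
  · grind [hv a l hal]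
  rcases eq_or_ne b l with rfl | hbl
  · grind [hv a i hai]
  · grind

/-- The integer part of `v a - v b` on the alcove reached after `k` steps of the alcove path. -/
def alcoveFloor (lam : Fin n → ℕ) (k : ℕ) (a b : Fin n) : ℤ :=
  rootCount lam k a b - rootCount lam k b a - if b < a then 1 else 0

theorem alcoveFloor_swap (lam : Fin n → ℕ) (k : ℕ) {a b : Fin n} (hab : a ≠ b) :
    alcoveFloor lam k b a = -1 - alcoveFloor lam k a b := by
  unfold alcoveFloor
  split_ifs <;> omega

theorem alcoveFloor_zero (lam : Fin n → ℕ) (a b : Fin n) :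
    alcoveFloor lam 0 a b = -if b < a then 1 else 0 := by
  simp [alcoveFloor, rootCount]

theorem rootCount_eq_zero (h : StrictAnti lam) (k : ℕ) {a b : Fin n} (hba : b < a) :
    rootCount lam k a b = 0 := by
  refine Finset.card_eq_zero.mpr (Finset.filter_eq_empty_iff.mpr fun p _ => ?_)
  rintro ⟨-, rfl, rfl⟩
  exact hba.not_gt (lo_lt_hi h p)

theorem alcoveFloor_lo_hi (h : StrictAnti lam) (p : Pos lam) :
    alcoveFloor lam p.val (entry lam p).lo (entry lam p).hi = level lam p - 1 := by
  have hlt := lo_lt_hi h p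
  rw [level_eq_rootCount, alcoveFloor, rootCount_eq_zero h _ hlt, if_neg hlt.not_gt]
  push_cast
  ring

theorem alcoveFloor_succ (lam : Fin n → ℕ) (p : Pos lam) (a b : Fin n) :
    alcoveFloor lam (p.val + 1) a b = alcoveFloor lam p.val a b +
      (if (entry lam p).lo = a ∧ (entry lam p).hi = b then 1 else 0) -
      (if (entry lam p).lo = b ∧ (entry lam p).hi = a then 1 else 0) := by
  unfold alcoveFloor
  rw [rootCount_succ, rootCount_succ]
  push_cast
  ring

theorem alcoveFloor_wall (h : StrictAnti lam) (p : Pos lam) {m : Fin n}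
    (hlo : m ≠ (entry lam p).lo) (hhi : m ≠ (entry lam p).hi) :
    alcoveFloor lam p.val (entry lam p).lo m =
      alcoveFloor lam p.val (entry lam p).lo (entry lam p).hi + 1 +
        alcoveFloor lam p.val (entry lam p).hi m := by
  classical
  have hlt := lo_lt_hi h p
  have hbounds := entry_bounds h p
  simp only [alcoveFloor, rootCount_eq h, RootBefore]
  rcases lt_or_gt_of_ne hlo with hmlo | hmlo
  · have := h hmlo
    grind
  rcases lt_or_gt_of_ne hhi with hmhi | hmhi
  · have := h hmlo
    have := h hmhi
    grind
  · have := h hmhi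
    grind

theorem affineWord_mem_strips (h : StrictAnti lam) {v : Fin n → ℝ} (hv : v ∈ fundamentalAlcove n)
    {k : ℕ} (hk : k ≤ (chain lam).length) :
    affineWord lam (sorted (Finset.univ.filter fun p : Pos lam => p.val < k)).reverse v ∈
      strips (alcoveFloor lam k) := by
  induction k with
  | zero =>
    intro a b hab
    simp only [sorted, affineWord, alcoveFloor_zero]
    rcases lt_or_gt_of_ne hab with hlt | hgt
    · simpa [hlt.not_gt] using (hv a b hlt).1
    · have := (hv b a hgt).2
      simp [hgt]
      linarith
  | succ k ih =>
    set p : Pos lam := ⟨k, hk⟩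
    have hstep := affineRefl_mem_strips (c := alcoveFloor lam p.val) (lo_lt_hi h p).ne
      (fun a b => alcoveFloor_swap lam k) (fun m => alcoveFloor_wall h p) (ih (by omega))
    simp only [← alcoveFloor_succ] at hstep
    rw [alcoveFloor_lo_hi h p, sub_add_cancel] at hstep
    rwa [show k + 1 = p.val + 1 from rfl, sorted_filter_lt_succ, List.reverse_append]

theorem sub_lt_level_of_mem_alcoveBefore (h : StrictAnti lam) (p : Pos lam) {v : Fin n → ℝ}
    (hv : v ∈ alcoveBefore lam p) :
    v (entry lam p).lo - v (entry lam p).hi < level lam p := by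
  obtain ⟨v, hv, rfl⟩ := hv
  have hlt := affineWord_mem_strips h hv p.isLt.le _ _ (lo_lt_hi h p).ne'
  rw [alcoveFloor_swap lam _ (lo_lt_hi h p).ne, alcoveFloor_lo_hi h] at hlt
  push_cast at hlt
  simp only [Fin.lt_def]
  linarith

theorem alcoveBefore_nonempty (lam : Fin n → ℕ) (p : Pos lam) : (alcoveBefore lam p).Nonempty := by
  refine Set.Nonempty.image _ ⟨fun i => -(i.val : ℝ) / n, fun a b hab => ?_⟩
  have hab' : (a.val : ℝ) < b.val := Nat.cast_lt.mpr hab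
  have hb : (b.val : ℝ) < n := Nat.cast_lt.mpr b.isLt
  have : (0 : ℝ) ≤ a.val := a.val.cast_nonneg
  have hn : (0 : ℝ) < n := by linarith
  rw [← sub_div, div_lt_one hn]
  exact ⟨div_pos (by linarith) hn, by linarith⟩

theorem hyperplane_swap (a b : Fin n) (c : ℤ) : hyperplane a b c = hyperplane b a (-c) := by
  ext v
  simp only [hyperplane, Set.mem_ofPred_eq]
  push_cast
  exact ⟨fun hv => by linarith, fun hv => by linarith⟩

theorem hyperplane_inj {a b a' b' : Fin n} {c c' : ℤ} (hab : a < b) (hab' : a' < b')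
    (heq : hyperplane a b c = hyperplane a' b' c') : a = a' ∧ b = b' ∧ c = c' := by
  have hmem : ∀ v : Fin n → ℝ, v a - v b = c → v a' - v b' = c' := fun v => (Set.ext_iff.mp heq v).1
  have hbase := hmem (Pi.single a (c : ℝ)) (by simp [hab.ne'])
  -- Translation along a coordinate other than `a` and `b` preserves the hyperplane.
  have hshift : ∀ m, m ≠ a → m ≠ b →
      (Pi.single m 1 : Fin n → ℝ) a' = (Pi.single m 1 : Fin n → ℝ) b' := by
    intro m hma hmb
    have := hmem (Pi.single a (c : ℝ) + Pi.single m 1) (by simp [hab.ne', hma.symm, hmb.symm])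
    simp only [Pi.add_apply] at this
    linarith
  have ha' : a' = a ∨ a' = b := by
    by_contra! hne
    simpa [hab'.ne'] using hshift a' hne.1 hne.2
  have hb' : b' = a ∨ b' = b := by
    by_contra! hne
    simpa [hab'.ne] using hshift b' hne.1 hne.2
  obtain ⟨rfl, rfl⟩ : a = a' ∧ b = b' := by grind
  refine ⟨rfl, rfl, ?_⟩
  simpa [hab.ne'] using hbase

theorem exists_foldedMap_apply (h : StrictAnti lam) (w : Equiv.Perm (Fin n))
    (J : Finset (Pos lam)) (p : Pos lam) :
    ∃ κ : Fin n → ℤ, ∀ v x,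
      foldedMap w J p v x = v ((w * phi (J.filter fun p' => p' < p))⁻¹ x) + κ x := by
  obtain ⟨κ, hκ⟩ := exists_affineWord_apply h (R := ℝ) (sorted (J.filter fun p' => p' < p))
  exact ⟨fun x => κ (w⁻¹ x), fun v x => by simp [foldedMap, permAct, hκ, phi]⟩

theorem image_hyperplane {g : (Fin n → ℝ) → Fin n → ℝ} {u : Equiv.Perm (Fin n)} {κ : Fin n → ℤ}
    (hg : ∀ v x, g v x = v (u⁻¹ x) + κ x) (i l : Fin n) (c : ℤ) :
    g '' hyperplane i l c = hyperplane (u i) (u l) (c + κ (u i) - κ (u l)) := by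
  ext y
  simp only [Set.mem_image, hyperplane, Set.mem_ofPred_eq]
  push_cast
  constructor
  · rintro ⟨v, hv, rfl⟩
    simp only [hg, Equiv.Perm.coe_inv, Equiv.symm_apply_apply]
    linarith
  · intro hy
    refine ⟨fun x => y (u x) - κ (u x), by linarith, funext fun x => ?_⟩
    simp only [hg, Equiv.Perm.coe_inv, Equiv.apply_symm_apply, sub_add_cancel]

theorem isPositiveFolding_iff (h : StrictAnti lam) (w : Equiv.Perm (Fin n))
    (J : Finset (Pos lam)) (p : Pos lam) :
    IsPositiveFolding w J p ↔
      (w * phi (J.filter fun p' => p' < p)) (entry lam p).hi <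
        (w * phi (J.filter fun p' => p' < p)) (entry lam p).lo := by
  obtain ⟨κ, hκ⟩ := exists_foldedMap_apply h w J p
  set u := w * phi (J.filter fun p' => p' < p)
  set i := (entry lam p).lo
  set l := (entry lam p).hi
  set c : ℤ := level lam p + κ (u i) - κ (u l)
  have hwall : foldedMap w J p '' hyperplane i l (level lam p) = hyperplane (u i) (u l) c :=
    image_hyperplane hκ i l (level lam p)
  have hside : ∀ y ∈ foldedMap w J p '' alcoveBefore lam p, y (u i) - y (u l) < c := by
    rintro _ ⟨v, hv, rfl⟩
    have := sub_lt_level_of_mem_alcoveBefore h p hv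
    simp only [hκ, Equiv.Perm.coe_inv, Equiv.symm_apply_apply]
    push_cast [c]
    linarith
  unfold IsPositiveFolding
  rw [hwall]
  constructor
  · rintro ⟨a, b, c', hab, hH, hA⟩
    by_contra! hle
    have hlt : u i < u l := hle.lt_of_ne (u.injective.ne (lo_lt_hi h p).ne)
    obtain ⟨rfl, rfl, rfl⟩ := hyperplane_inj hlt hab hH
    obtain ⟨y, hy⟩ := (alcoveBefore_nonempty lam p).image (foldedMap w J p)
    exact (hside y hy).not_gt (hA hy)
  · intro hlt
    refine ⟨u l, u i, -c, hlt, hyperplane_swap _ _ _, fun y hy => ?_⟩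
    have := hside y hy
    simp only [Set.mem_ofPred_eq]
    push_cast
    linarith

/-! ### The weight and the content -/

/-- The product of the transpositions of those positions in `ps` that lie in the segments `Γ_k`
with `j < k`; for `ps = sorted J` and a permutation `w`, the filling of column `j` is
`w * wordAbove ps j`. -/
def wordAbove (ps : List (Pos lam)) (j : ℕ) : Equiv.Perm (Fin n) :=
  ((ps.filter fun p => j < (entry lam p).col).map (refl lam)).prod

theorem piPerm_eq (w : Equiv.Perm (Fin n)) (J : Finset (Pos lam)) (j : ℕ) :
    piPerm w J j = w * wordAbove (sorted J) j := by
  rw [piPerm, phi, sorted_filter, wordAbove]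

theorem wordAbove_eq_one {ps : List (Pos lam)} {j : ℕ} (hps : ∀ p ∈ ps, (entry lam p).col ≤ j) :
    wordAbove ps j = 1 := by
  have hnil : (ps.filter fun p => j < (entry lam p).col) = [] :=
    List.filter_eq_nil_iff.mpr fun p hp => by simpa using hps p hp
  rw [wordAbove, hnil, List.map_nil, List.prod_nil]

theorem wordAbove_cons {p : Pos lam} {j : ℕ} (hj : j < (entry lam p).col) (ps : List (Pos lam)) :
    wordAbove (p :: ps) j = refl lam p * wordAbove ps j := by
  rw [wordAbove, List.filter_cons_of_pos (by simpa using hj), List.map_cons, List.prod_cons,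
    wordAbove]

/-- The number of columns of the filling of `(1, J)`, `ps = sorted J`, in which `x` occurs. -/
def columnCount (ps : List (Pos lam)) (x : Fin n) : ℕ :=
  ((Finset.Icc 1 (numCols lam)).filter fun j => j ≤ lam ((wordAbove ps j)⁻¹ x)).card

theorem columnCount_eq {ps : List (Pos lam)} {c : ℕ} (hc : 1 ≤ c)
    (hps : ∀ p ∈ ps, (entry lam p).col ≤ c) (x : Fin n) :
    columnCount ps x = ((Finset.Ico 1 c).filter fun j => j ≤ lam ((wordAbove ps j)⁻¹ x)).card +
      (lam x + 1 - c) := by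
  rw [columnCount, ← Nat.card_Icc, ← Finset.card_union_of_disjoint]
  · congr 1
    ext j
    have hle := le_numCols lam ((wordAbove ps j)⁻¹ x)
    simp only [Finset.mem_filter, Finset.mem_union, Finset.mem_Icc, Finset.mem_Ico]
    rcases lt_or_ge j c with hj | hj
    · omega
    · rw [wordAbove_eq_one fun p hp => (hps p hp).trans hj, inv_one, Equiv.Perm.one_apply] at hle ⊢
      omega
  · refine Finset.disjoint_left.mpr fun j hj hj' => ?_
    simp only [Finset.mem_filter, Finset.mem_Icc, Finset.mem_Ico] at hj hj'
    omega

theorem columnCount_cons {p : Pos lam} {ps : List (Pos lam)} (hp : 1 ≤ (entry lam p).col)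
    (hps : ∀ p' ∈ ps, (entry lam p').col ≤ (entry lam p).col) (x : Fin n) :
    columnCount (p :: ps) x + (lam (refl lam p x) + 1 - (entry lam p).col) =
      columnCount ps (refl lam p x) + (lam x + 1 - (entry lam p).col) := by
  rw [columnCount_eq hp hps, columnCount_eq hp (List.forall_mem_cons.mpr ⟨le_rfl, hps⟩),
    add_right_comm]
  congr 3
  refine Finset.filter_congr fun j hj => ?_
  rw [wordAbove_cons (Finset.mem_Ico.mp hj).2, mul_inv_rev, Equiv.Perm.mul_apply, refl,
    Equiv.swap_inv]

theorem affineWord_lam (h : StrictAnti lam) {ps : List (Pos lam)} (hps : ps.Pairwise (· < ·))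
    (x : Fin n) : affineWord lam ps (fun i => (lam i : ℤ)) x = columnCount ps x := by
  induction ps generalizing x with
  | nil => simp [affineWord, columnCount_eq (ps := ([] : List (Pos lam))) le_rfl (by simp) x]
  | cons p ps ih =>
    rw [List.pairwise_cons] at hps
    have hne := (lo_lt_hi h p).ne
    have hbounds := entry_bounds h p
    have hcons := columnCount_cons (by omega) (fun p' hp' => col_le_of_lt lam (hps.1 p' hp')) x
    change affineRefl (entry lam p).lo (entry lam p).hi (level lam p) (affineWord lam ps _) x = _
    rw [affineRefl_apply hne, ih hps.2, level_eq h, ← refl]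
    rcases eq_or_ne x (entry lam p).lo with rfl | hlo
    · rw [refl, Equiv.swap_apply_left] at hcons ⊢
      rw [if_pos rfl, if_neg hne]
      push_cast
      omega
    rcases eq_or_ne x (entry lam p).hi with rfl | hhi
    · rw [refl, Equiv.swap_apply_right] at hcons ⊢
      rw [if_pos rfl, if_neg hne.symm]
      push_cast
      omega
    · rw [refl, Equiv.swap_apply_of_ne_of_ne hlo hhi] at hcons ⊢
      rw [if_neg hlo, if_neg hhi]
      push_cast
      omega

theorem permAct_mu (h : StrictAnti lam) (w : Equiv.Perm (Fin n)) (J : Finset (Pos lam)) :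
    permAct w (mu J) = content (fillingMap lam w J) := by
  funext a
  rw [permAct, mu, affineWord_lam h (pairwise_sorted J), content, Nat.cast_inj, columnCount]
  have hinv : ∀ j, (wordAbove (sorted J) j)⁻¹ (w⁻¹ a) = (piPerm w J j)⁻¹ a := fun j => by
    rw [piPerm_eq, mul_inv_rev, Equiv.Perm.mul_apply]
  simp only [hinv]
  refine (Finset.card_bij (fun u _ => u.1.2) ?_ ?_ fun j hj => ?_).symm
  · rintro ⟨⟨i, j⟩, hu⟩ hσ
    replace hσ : piPerm w J j i = a := (Finset.mem_filter.mp hσ).2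
    rw [mem_diagram] at hu
    rw [Finset.mem_filter, Finset.mem_Icc, ← hσ, Equiv.Perm.coe_inv, Equiv.symm_apply_apply]
    exact ⟨⟨hu.1, hu.2.trans (le_numCols lam i)⟩, hu.2⟩
  · rintro ⟨⟨i, j⟩, hu⟩ hσ ⟨⟨i', j'⟩, hu'⟩ hσ' hjj'
    replace hσ : piPerm w J j i = a := (Finset.mem_filter.mp hσ).2
    replace hσ' : piPerm w J j' i' = a := (Finset.mem_filter.mp hσ').2
    obtain rfl : j = j' := hjj'
    obtain rfl : i = i' := (piPerm w J j).injective (hσ.trans hσ'.symm)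
    rfl
  · rw [Finset.mem_filter, Finset.mem_Icc] at hj
    exact ⟨⟨((piPerm w J j)⁻¹ a, j), mem_diagram.mpr ⟨hj.1.1, hj.2⟩⟩,
      Finset.mem_filter.mpr ⟨Finset.mem_univ _, by simp [fillingMap]⟩, rfl⟩

/-! ### Arcs in the cyclic order and lengths of permutations -/

open Classical in
/-- The number of rows in `S` whose entry in the column `v` lies strictly inside the arc that runs
from `a` upwards to `b` in the cyclic order of `Fin n`. -/
noncomputable def arcCount (S : Finset (Fin n)) (v : Fin n → Fin n) (a b : Fin n) : ℕ :=
  (S.filter fun m => sbtw a (v m) b).card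

theorem arcCount_congr {S : Finset (Fin n)} {v v' : Fin n → Fin n} (h : ∀ m ∈ S, v m = v' m)
    (a b : Fin n) : arcCount S v a b = arcCount S v' a b := by
  classical
  rw [arcCount, arcCount, Finset.filter_congr fun m hm => by rw [h m hm]]

theorem arcCount_self (S : Finset (Fin n)) (v : Fin n → Fin n) (a : Fin n) :
    arcCount S v a a = 0 := by
  simp [arcCount, sbtw_irrefl_left_right]

open Classical in
theorem arcCount_insert {S : Finset (Fin n)} {l : Fin n} (hl : l ∉ S) (v : Fin n → Fin n)
    (a b : Fin n) :
    arcCount (insert l S) v a b = arcCount S v a b + if sbtw a (v l) b then 1 else 0 := by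
  rw [arcCount, arcCount, Finset.filter_insert]
  split_ifs
  · rw [Finset.card_insert_of_notMem fun hmem => hl (Finset.mem_filter.mp hmem).1]
  · rw [add_zero]

theorem arcCount_add {S : Finset (Fin n)} {v : Fin n → Fin n} {a x b : Fin n} (h : sbtw a x b)
    (hx : ∀ m ∈ S, v m ≠ x) : arcCount S v a x + arcCount S v x b = arcCount S v a b := by
  classical
  rw [arcCount, arcCount, arcCount, ← Finset.card_union_of_disjoint]
  · rw [← Finset.filter_or]
    refine congrArg Finset.card (Finset.filter_congr fun m hm => ?_)
    have := hx m hm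
    rw [Fin.sbtw_iff] at h ⊢
    rw [Fin.sbtw_iff, Fin.sbtw_iff]
    omega
  · refine Finset.disjoint_filter.mpr fun m _ hm => ?_
    rw [Fin.sbtw_iff] at h hm ⊢
    omega

theorem arcCount_add_arcCount_swap {S : Finset (Fin n)} {v : Fin n → Fin n} {a b : Fin n}
    (hab : a ≠ b) (ha : ∀ m ∈ S, v m ≠ a) (hb : ∀ m ∈ S, v m ≠ b) :
    arcCount S v a b + arcCount S v b a = S.card := by
  classical
  rw [arcCount, arcCount, ← Finset.card_filter_add_card_filter_not (s := S)
    fun m => sbtw a (v m) b]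
  congr 2
  refine Finset.filter_congr fun m hm => ?_
  have := ha m hm
  have := hb m hm
  rw [Fin.sbtw_iff, Fin.sbtw_iff]
  omega

theorem sum_sum_eq_of_support {ι : Type*} [Fintype ι] [DecidableEq ι] {M : Type*}
    [AddCommMonoid M] {S : Finset ι} {f : ι → ι → M} (hf : ∀ a ∉ S, ∀ b ∉ S, f a b = 0) :
    ∑ a, ∑ b, f a b = ∑ x ∈ S, ∑ y ∈ S, f x y + ∑ m ∈ Sᶜ, ∑ x ∈ S, (f x m + f m x) := by
  have houter : ∀ a ∈ Sᶜ, ∑ b, f a b = ∑ x ∈ S, f a x := fun a ha => by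
    rw [← Finset.sum_add_sum_compl S, Finset.sum_eq_zero (s := Sᶜ) fun b hb =>
      hf a (Finset.mem_compl.mp ha) b (Finset.mem_compl.mp hb), add_zero]
  rw [← Finset.sum_add_sum_compl S, Finset.sum_congr rfl houter, Finset.sum_comm (s := Sᶜ)]
  simp only [← Finset.sum_add_sum_compl S (f _), Finset.sum_add_distrib, add_assoc]
  rw [Finset.sum_comm (s := Sᶜ), Finset.sum_comm (s := Sᶜ)]

theorem permLength_mul (v s : Equiv.Perm (Fin n)) :
    (permLength (v * s) : ℤ) = ∑ a, ∑ b, if s⁻¹ a < s⁻¹ b ∧ v b < v a then 1 else 0 := by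
  have hlen : (permLength (v * s) : ℤ) =
      ∑ a, ∑ b, if a < b ∧ (v * s) b < (v * s) a then 1 else 0 := by
    rw [← Finset.sum_product', Finset.univ_product_univ, Finset.sum_boole]
    rfl
  rw [hlen, ← Equiv.sum_comp s⁻¹]
  refine Finset.sum_congr rfl fun a _ => ?_
  rw [← Equiv.sum_comp s⁻¹]
  simp only [Equiv.Perm.mul_apply, Equiv.Perm.coe_inv, Equiv.apply_symm_apply]

/-- The contribution of the pair of rows `(a, b)` to `ℓ(v s) - ℓ(v)`. -/
def inversionChange (v s : Equiv.Perm (Fin n)) (a b : Fin n) : ℤ :=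
  (if s⁻¹ a < s⁻¹ b ∧ v b < v a then 1 else 0) - if a < b ∧ v b < v a then 1 else 0

theorem permLength_mul_sub (v s : Equiv.Perm (Fin n)) :
    (permLength (v * s) : ℤ) - permLength v = ∑ a, ∑ b, inversionChange v s a b := by
  have hone := permLength_mul v 1
  rw [mul_one] at hone
  rw [hone, permLength_mul]
  simp only [inversionChange, Finset.sum_sub_distrib]
  rfl

theorem sum_inversionChange_swap (v : Equiv.Perm (Fin n)) {i l m : Fin n} (hil : i < l)
    (hm : m ∉ ({i, l} : Finset (Fin n))) [Decidable (sbtw (v i) (v m) (v l))] :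
    ∑ x ∈ {i, l}, (inversionChange v (Equiv.swap i l) x m +
      inversionChange v (Equiv.swap i l) m x) =
    if m ∈ rowsBetween i l then
      2 * ((if sbtw (v i) (v m) (v l) then 1 else 0) - if v l < v i then 1 else 0) else 0 := by
  rw [Finset.mem_insert, Finset.mem_singleton, not_or] at hm
  have hmi := v.injective.ne hm.1
  have hml := v.injective.ne hm.2
  have := v.injective.ne hil.ne
  rw [Finset.sum_pair hil.ne]
  simp only [inversionChange, Equiv.swap_inv, Equiv.swap_apply_left, Equiv.swap_apply_right,
    Equiv.swap_apply_of_ne_of_ne hm.1 hm.2, mem_rowsBetween, Fin.sbtw_iff]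
  grind

theorem permLength_mul_swap (v : Equiv.Perm (Fin n)) {i l : Fin n} (hil : i < l) :
    (permLength (v * Equiv.swap i l) : ℤ) - permLength v - 1 =
      2 * (arcCount (rowsBetween i l) v (v i) (v l) -
        if v l < v i then (l.val - i.val : ℤ) else 0) := by
  classical
  have hsupport : ∀ a ∉ ({i, l} : Finset (Fin n)), ∀ b ∉ ({i, l} : Finset (Fin n)),
      inversionChange v (Equiv.swap i l) a b = 0 := fun a ha b hb => by
    simp only [Finset.mem_insert, Finset.mem_singleton, not_or] at ha hb
    rw [inversionChange, Equiv.swap_inv, Equiv.swap_apply_of_ne_of_ne ha.1 ha.2,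
      Equiv.swap_apply_of_ne_of_ne hb.1 hb.2, sub_self]
  have hsub : rowsBetween i l ⊆ ({i, l} : Finset (Fin n))ᶜ := fun m hm => by
    simp only [mem_rowsBetween, Finset.mem_compl, Finset.mem_insert, Finset.mem_singleton] at hm ⊢
    omega
  rw [permLength_mul_sub, sum_sum_eq_of_support hsupport,
    Finset.sum_congr rfl fun m hm => sum_inversionChange_swap v hil (Finset.mem_compl.mp hm),
    ← Finset.sum_filter, Finset.filter_mem_eq_inter, Finset.inter_eq_right.mpr hsub,
    ← Finset.mul_sum, Finset.sum_sub_distrib, Finset.sum_boole, Finset.sum_const,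
    card_rowsBetween i l.isLt.le, arcCount, Finset.sum_pair hil.ne, Finset.sum_pair hil.ne,
    Finset.sum_pair hil.ne]
  have hil' := v.injective.ne hil.ne
  simp only [inversionChange, Equiv.swap_inv, Equiv.swap_apply_left, Equiv.swap_apply_right,
    nsmul_eq_mul]
  grind

variable {K : Type*} [Field K]

/-! ### Coefficients of foldings and of exchanges -/

/-- The weight of the arc from `a` upwards to `b`: a factor `t` for each row of `S` with entry
inside the arc, and a factor `Q` if the arc wraps around. -/
noncomputable def arcWeight (Q t : K) (S : Finset (Fin n)) (v : Fin n → Fin n) (a b : Fin n) : K :=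
  (if b < a then Q else 1) * t ^ arcCount S v a b

theorem arcWeight_self (Q t : K) (S : Finset (Fin n)) (v : Fin n → Fin n) (a : Fin n) :
    arcWeight Q t S v a a = 1 := by
  rw [arcWeight, if_neg (lt_irrefl a), arcCount_self, pow_zero, one_mul]

theorem arcWeight_congr (Q t : K) {S : Finset (Fin n)} {v v' : Fin n → Fin n}
    (h : ∀ m ∈ S, v m = v' m) (a b : Fin n) :
    arcWeight Q t S v a b = arcWeight Q t S v' a b := by
  rw [arcWeight, arcWeight, arcCount_congr h]

open Classical in
theorem arcWeight_insert (Q t : K) {S : Finset (Fin n)} {l : Fin n} (hl : l ∉ S)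
    (v : Fin n → Fin n) (a b : Fin n) : arcWeight Q t (insert l S) v a b =
      arcWeight Q t S v a b * if sbtw a (v l) b then t else 1 := by
  rw [arcWeight, arcWeight, arcCount_insert hl, pow_add, ← mul_assoc]
  split_ifs <;> simp

theorem arcWeight_mul (Q t : K) {S : Finset (Fin n)} {v : Fin n → Fin n} {a x b : Fin n}
    (h : sbtw a x b) (hx : ∀ m ∈ S, v m ≠ x) :
    arcWeight Q t S v a x * arcWeight Q t S v x b = arcWeight Q t S v a b := by
  rw [arcWeight, arcWeight, arcWeight, ← arcCount_add h hx, pow_add, mul_mul_mul_comm]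
  rw [Fin.sbtw_iff] at h
  congr 1
  split_ifs <;> first | omega | simp

theorem arcWeight_mul_swap (Q t : K) {S : Finset (Fin n)} {v : Fin n → Fin n} {a b : Fin n}
    (hab : a ≠ b) (ha : ∀ m ∈ S, v m ≠ a) (hb : ∀ m ∈ S, v m ≠ b) :
    arcWeight Q t S v a b * arcWeight Q t S v b a = Q * t ^ S.card := by
  rw [arcWeight, arcWeight, ← arcCount_add_arcCount_swap hab ha hb, pow_add, mul_mul_mul_comm]
  congr 1
  split_ifs <;> first | omega | simp

theorem rowsBetween_succ {i l : Fin n} (hil : i < l) :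
    rowsBetween i (l.val + 1) = insert l (rowsBetween i l.val) := by
  ext m
  simp only [Finset.mem_insert, mem_rowsBetween]
  omega

theorem notMem_rowsBetween (i l : Fin n) : l ∉ rowsBetween i l.val := by
  simp [mem_rowsBetween]

/-- The total weight of the ways to replace the entry in row `i` of the column `v` by `b` through
exchanges with rows `≥ l`; for `b = v l` it is the weight of the single exchange with row `l`. -/
noncomputable def exchangeCoeff (Q t : K) (v : Fin n → Fin n) (i : Fin n) (l : ℕ) (b : Fin n) : K :=
  arcWeight Q t (rowsBetween i l) v (v i) b *
    if v i = b then 1 else (1 - t) / (1 - Q * t ^ (l - i.val))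

theorem exchangeCoeff_self (Q t : K) (v : Fin n → Fin n) (i : Fin n) (l : ℕ) :
    exchangeCoeff Q t v i l (v i) = 1 := by
  rw [exchangeCoeff, arcWeight_self, if_pos rfl, mul_one]

theorem exchangeCoeff_of_ne (Q t : K) {v : Fin n → Fin n} {i b : Fin n} (h : v i ≠ b) (l : ℕ) :
    exchangeCoeff Q t v i l b = arcWeight Q t (rowsBetween i l) v (v i) b *
      ((1 - t) / (1 - Q * t ^ (l - i.val))) := by
  rw [exchangeCoeff, if_neg h]

open Classical in
/-- Either the arc from `a` to `b` splits at `x`, or the arc from `a` to `x` splits at `b`, in which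
case the arcs from `x` to `b` and back run once around the circle. -/
theorem arcWeight_exchange {Q t : K} {S : Finset (Fin n)} {v : Fin n → Fin n} {a x b : Fin n}
    (hax : a ≠ x) (hxb : x ≠ b) (hab : a ≠ b) (hx : ∀ m ∈ S, v m ≠ x) (hb : ∀ m ∈ S, v m ≠ b)
    (hd : 1 - Q * t ^ (S.card + 1) ≠ 0) (hd' : 1 - Q * t ^ (S.card + 2) ≠ 0) :
    arcWeight Q t S v a b * (if sbtw a x b then t else 1) *
        ((1 - t) / (1 - Q * t ^ (S.card + 2))) +
      arcWeight Q t S v a x * ((1 - t) / (1 - Q * t ^ (S.card + 1))) *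
        (arcWeight Q t S v x b * (if sbtw x a b then t else 1) *
          ((1 - t) / (1 - Q * t ^ (S.card + 2)))) =
    arcWeight Q t S v a b * ((1 - t) / (1 - Q * t ^ (S.card + 1))) := by
  have hcases : (sbtw a x b ∧ ¬ sbtw x a b) ∨ (sbtw a b x ∧ ¬ sbtw a x b ∧ sbtw x a b) := by
    simp only [Fin.sbtw_iff]
    omega
  rcases hcases with ⟨h, h'⟩ | ⟨h, h', h''⟩
  · rw [if_pos h, if_neg h', ← arcWeight_mul Q t h hx]
    field_simp
    ring
  · have hcircle := arcWeight_mul_swap Q t hxb hx hb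
    rw [if_neg h', if_pos h'', ← arcWeight_mul Q t h hb]
    field_simp
    linear_combination (1 - t) ^ 2 * arcWeight Q t S v a b * t * hcircle

/-- An exchange with a row `≥ l` that brings in the value `b` of a row below `l` may pass through
row `l` or not. -/
theorem exchangeCoeff_succ_add {Q t : K} (hQ : ∀ d : ℕ, 1 ≤ d → 1 - Q * t ^ d ≠ 0)
    (v : Equiv.Perm (Fin n)) {i l m : Fin n} (hil : i < l) (hlm : l < m) :
    exchangeCoeff Q t v i (l.val + 1) (v m) + exchangeCoeff Q t v i l (v l) *
      exchangeCoeff Q t (v * Equiv.swap i l : Equiv.Perm (Fin n)) i (l.val + 1) (v m) =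
    exchangeCoeff Q t v i l (v m) := by
  classical
  have hcard : (rowsBetween i l.val).card + 1 = l.val - i.val := by
    rw [card_rowsBetween i l.isLt.le]
    omega
  have hcard' : (rowsBetween i l.val).card + 2 = l.val + 1 - i.val := by omega
  have hil' : v i ≠ v l := v.injective.ne hil.ne
  have hlm' : v l ≠ v m := v.injective.ne hlm.ne
  have him' : v i ≠ v m := v.injective.ne (hil.trans hlm).ne
  have hswap : (v * Equiv.swap i l) i = v l := by simp
  have hcongr : ∀ k ∈ rowsBetween i l.val, (v * Equiv.swap i l) k = v k := fun k hk => by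
    rw [mem_rowsBetween] at hk
    rw [Equiv.Perm.mul_apply, Equiv.swap_apply_of_ne_of_ne hk.1.ne' (Fin.ne_of_lt hk.2)]
  rw [exchangeCoeff_of_ne Q t him', exchangeCoeff_of_ne Q t hil', exchangeCoeff_of_ne Q t him',
    exchangeCoeff_of_ne Q t (hswap.trans_ne hlm'), rowsBetween_succ hil,
    arcWeight_insert Q t (notMem_rowsBetween i l), arcWeight_insert Q t (notMem_rowsBetween i l),
    arcWeight_congr Q t hcongr, hswap, Equiv.Perm.mul_apply, Equiv.swap_apply_right, ← hcard,
    ← hcard']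
  refine arcWeight_exchange hil' hlm' him' (fun k hk => v.injective.ne ?_)
    (fun k hk => v.injective.ne ?_) (hQ _ (by omega)) (hQ _ (by omega))
  · exact Fin.ne_of_lt (mem_rowsBetween.1 hk).2
  · exact Fin.ne_of_lt ((mem_rowsBetween.1 hk).2.trans hlm)

theorem exchangeCoeff_eq_zpow {t : K} (ht : t ≠ 0) (Q : K) (v : Equiv.Perm (Fin n)) {i l : Fin n}
    (hil : i < l) : exchangeCoeff Q t v i l (v l) =
      t ^ (((permLength (v * Equiv.swap i l) : ℤ) - permLength v - 1) / 2) * (1 - t) *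
        ((if v i < v l then 1 else Q * t ^ (l.val - i.val)) /
          (1 - Q * t ^ (l.val - i.val))) := by
  have hne := v.injective.ne hil.ne
  rw [permLength_mul_swap v hil, Int.mul_ediv_cancel_left _ two_ne_zero,
    exchangeCoeff_of_ne Q t hne, arcWeight]
  rcases lt_or_gt_of_ne hne with hlt | hgt
  · rw [if_neg hlt.not_gt, if_neg hlt.not_gt, if_pos hlt, sub_zero, zpow_natCast]
    ring
  · rw [if_pos hgt, if_pos hgt, if_neg hgt.not_gt, zpow_sub₀ ht, zpow_natCast,
      ← Nat.cast_sub hil.le, zpow_natCast]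
    field_simp

/-! ### Weights of walks -/

/-- The transposition attached to an entry of the chain. -/
def entrySwap (e : Entry n) : Equiv.Perm (Fin n) := Equiv.swap e.lo e.hi

/-- The weight of a folding at `e` that leads to the permutation `v`. -/
noncomputable def stepCoeff (lam : Fin n → ℕ) (q t : K) (e : Entry n) (v : Equiv.Perm (Fin n)) :
    K :=
  exchangeCoeff (q ^ arm lam (e.lo, e.col - 1)) t v e.lo e.hi.val (v e.hi)

/-- The weight of the alcove walk that starts at `w` and folds at the entries of a list. -/
noncomputable def walkCoeff (lam : Fin n → ℕ) (q t : K) : Equiv.Perm (Fin n) → List (Entry n) → K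
  | _, [] => 1
  | w, e :: s => stepCoeff lam q t e (w * entrySwap e) * walkCoeff lam q t (w * entrySwap e) s

theorem walkCoeff_append (lam : Fin n → ℕ) (q t : K) (w : Equiv.Perm (Fin n))
    (s s' : List (Entry n)) : walkCoeff lam q t w (s ++ s') =
      walkCoeff lam q t w s * walkCoeff lam q t (w * (s.map entrySwap).prod) s' := by
  induction s generalizing w with
  | nil => simp [walkCoeff]
  | cons e s ih =>
    simp only [List.cons_append, walkCoeff, ih, List.map_cons, List.prod_cons, mul_assoc]

/-- The factor of the Ram–Yip formula for a folding at position `p` that starts from the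
permutation `u`. -/
def foldingFactor (q t : K) (u : Equiv.Perm (Fin n)) (p : Pos lam) : K :=
  (if u (entry lam p).hi < u (entry lam p).lo then 1 else qtFactor lam q t p) /
    (1 - qtFactor lam q t p)

theorem stepCoeff_entry (h : StrictAnti lam) (q : K) {t : K} (ht : t ≠ 0)
    (w : Equiv.Perm (Fin n)) (p : Pos lam) :
    stepCoeff lam q t (entry lam p) (w * refl lam p) =
      t ^ (((permLength w : ℤ) - permLength (w * refl lam p) - 1) / 2) * (1 - t) *
        foldingFactor q t w p := by
  rw [stepCoeff, exchangeCoeff_eq_zpow ht _ _ (lo_lt_hi h p), foldingFactor, qtFactor, refl,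
    mul_assoc w, Equiv.swap_mul_self, mul_one, Equiv.Perm.mul_apply, Equiv.Perm.mul_apply,
    Equiv.swap_apply_left, Equiv.swap_apply_right]

theorem even_permLength_sub (h : StrictAnti lam) (w : Equiv.Perm (Fin n)) (p : Pos lam) :
    Even ((permLength w : ℤ) - permLength (w * refl lam p) - 1) := by
  have hlen := permLength_mul_swap (w * refl lam p) (lo_lt_hi h p)
  rw [refl, mul_assoc, Equiv.swap_mul_self, mul_one] at hlen
  exact hlen ▸ even_two_mul _

theorem walkCoeff_map_entry (h : StrictAnti lam) (q : K) {t : K} (ht : t ≠ 0)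
    (w : Equiv.Perm (Fin n)) {ps : List (Pos lam)} (hps : ps.Pairwise (· < ·)) :
    walkCoeff lam q t w (ps.map (entry lam)) =
      t ^ (((permLength w : ℤ) - permLength (w * (ps.map (refl lam)).prod) - ps.length) / 2) *
        (1 - t) ^ ps.length * (ps.map fun p =>
          foldingFactor q t (w * ((ps.filter (· < p)).map (refl lam)).prod) p).prod := by
  induction ps generalizing w with
  | nil => simp [walkCoeff]
  | cons p ps ih =>
    rw [List.pairwise_cons] at hps
    have hhead : (p :: ps).filter (· < p) = [] :=
      List.filter_eq_nil_iff.mpr fun p' hp' => by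
        rcases List.mem_cons.mp hp' with rfl | hp'
        · simp
        · simpa using (hps.1 p' hp').le
    have htail : ∀ p' ∈ ps, foldingFactor q t
        (w * (((p :: ps).filter (· < p')).map (refl lam)).prod) p' = foldingFactor q t
        (w * refl lam p * ((ps.filter (· < p')).map (refl lam)).prod) p' := fun p' hp' => by
      rw [List.filter_cons_of_pos (by simpa using hps.1 p' hp'), List.map_cons, List.prod_cons,
        mul_assoc]
    obtain ⟨k, hk⟩ := even_iff_two_dvd.mp (even_permLength_sub h w p)
    have hlen : (permLength w : ℤ) - permLength (w * refl lam p * (ps.map (refl lam)).prod) -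
        (ps.length + 1) = (permLength (w * refl lam p) -
          permLength (w * refl lam p * (ps.map (refl lam)).prod) - ps.length) + 2 * k := by
      linarith
    rw [List.map_cons, walkCoeff, ← show refl lam p = entrySwap (entry lam p) from rfl,
      stepCoeff_entry h q ht, ih _ hps.2, hk, Int.mul_ediv_cancel_left _ two_ne_zero,
      List.map_cons, List.map_cons, List.prod_cons, List.prod_cons, ← mul_assoc w, hhead,
      List.map_congr_left htail, List.length_cons, Nat.cast_succ, hlen,
      Int.add_mul_ediv_left _ _ two_ne_zero, zpow_add₀ ht, pow_succ, List.map_nil, List.prod_nil,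
      mul_one]
    ring

theorem nodup_sorted (J : Finset (Pos lam)) : (sorted J).Nodup :=
  (pairwise_sorted J).imp ne_of_lt

theorem toFinset_sorted (J : Finset (Pos lam)) : (sorted J).toFinset = J := by
  ext p
  simp only [List.mem_toFinset, mem_sorted]

theorem weight_eq_walkCoeff (h : StrictAnti lam) (q : K) {t : K} (ht : t ≠ 0)
    (w : Equiv.Perm (Fin n)) (J : Finset (Pos lam)) :
    weight q t w J = walkCoeff lam q t w ((sorted J).map (entry lam)) := by
  classical
  rw [walkCoeff_map_entry h q ht w (pairwise_sorted J), ← List.prod_toFinset _ (nodup_sorted J),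
    ← List.toFinset_card_of_nodup (nodup_sorted J), toFinset_sorted, weight, phi,
    mul_assoc _ (∏ p ∈ _, _), Jpos, Jneg, ← Finset.prod_ite]
  refine congrArg _ (Finset.prod_congr rfl fun p _ => ?_)
  simp only [isPositiveFolding_iff h, phi, sorted_filter, foldingFactor]
  split_ifs <;> rfl

/-! ### Sums over walks -/

theorem sum_sorted {M : Type*} [AddCommMonoid M] (G : List (Pos lam) → M) : ∑ J, G (sorted J) =
    ((List.finRange (chain lam).length).sublists'.map G).sum := by
  rw [← List.sum_toFinset _ (List.nodup_sublists'.mpr (List.nodup_finRange _))]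
  refine Finset.sum_bij' (fun J _ => sorted J) (fun s _ => s.toFinset) (fun J _ => ?_)
    (fun _ _ => Finset.mem_univ _) (fun J _ => toFinset_sorted J) (fun s hs => ?_) fun _ _ => rfl
  · rw [List.mem_toFinset, List.mem_sublists']
    exact List.filter_sublist
  · rw [List.mem_toFinset, List.mem_sublists'] at hs
    exact sorted_eq_of_mem_iff ((List.pairwise_lt_finRange _).sublist hs)
      fun p => List.mem_toFinset.symm

theorem sum_map_entry_sorted (lam : Fin n → ℕ) {M : Type*} [AddCommMonoid M]
    (G : List (Entry n) → M) :
    ∑ J : Finset (Pos lam), G ((sorted J).map (entry lam)) =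
      ((chain lam).sublists'.map G).sum := by
  have hchain : (List.finRange (chain lam).length).map (entry lam) = chain lam :=
    List.map_get_finRange _
  rw [sum_sorted fun s => G (s.map (entry lam)), ← Function.comp_def G, ← List.map_map,
    ← List.sublists'_map, hchain]

theorem sum_sublists'_append {α M : Type*} [AddCommMonoid M] (L L' : List α) (G : List α → M) :
    ((L ++ L').sublists'.map G).sum =
      (L.sublists'.map fun s => (L'.sublists'.map fun s' => G (s ++ s')).sum).sum := by
  induction L generalizing G with
  | nil => simp
  | cons e L ih =>
    simp only [List.cons_append, List.sublists'_cons, List.map_append, List.map_map,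
      List.sum_append, Function.comp_def, ih]

/-- The effect on the coefficients of permutations of allowing a folding at `e`. -/
noncomputable def foldStep (lam : Fin n → ℕ) (q t : K) (F : Equiv.Perm (Fin n) → K)
    (e : Entry n) : Equiv.Perm (Fin n) → K :=
  fun v => F v + stepCoeff lam q t e v * F (v * entrySwap e)

/-- The effect on the coefficients of permutations of allowing foldings at the entries of a list:
the new coefficient of `v` is the weighted sum over the walks that end at `v`. -/
noncomputable def transfer (lam : Fin n → ℕ) (q t : K) (L : List (Entry n))
    (F : Equiv.Perm (Fin n) → K) : Equiv.Perm (Fin n) → K :=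
  L.foldl (foldStep lam q t) F

theorem transfer_append (lam : Fin n → ℕ) (q t : K) (L L' : List (Entry n))
    (F : Equiv.Perm (Fin n) → K) :
    transfer lam q t (L ++ L') F = transfer lam q t L' (transfer lam q t L F) :=
  List.foldl_append

theorem sum_walkCoeff (lam : Fin n → ℕ) (q t : K) (L : List (Entry n))
    (F G : Equiv.Perm (Fin n) → K) :
    ∑ w, F w * (L.sublists'.map fun s =>
      walkCoeff lam q t w s * G (w * (s.map entrySwap).prod)).sum =
        ∑ v, transfer lam q t L F v * G v := by
  induction L generalizing F with
  | nil => simp [walkCoeff, transfer]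
  | cons e L ih =>
    have hswap : ∀ w : Equiv.Perm (Fin n), w * entrySwap e * entrySwap e = w := fun w => by
      rw [mul_assoc, entrySwap, Equiv.swap_mul_self, mul_one]
    rw [show transfer lam q t (e :: L) F = transfer lam q t L (foldStep lam q t F e) from rfl,
      ← ih]
    simp only [List.sublists'_cons, List.map_append, List.map_map, List.sum_append,
      Function.comp_def, walkCoeff, List.map_cons, List.prod_cons, mul_assoc, List.sum_map_mul_left,
      foldStep, mul_add, add_mul, Finset.sum_add_distrib]
    congr 1
    rw [← Equiv.sum_comp (Equiv.mulRight (entrySwap e))]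
    refine Finset.sum_congr rfl fun v _ => ?_
    simp only [Equiv.coe_mulRight, hswap, ← mul_assoc]
    rw [mul_comm (F _)]

/-! ### Foldings in one row of a segment -/

theorem filter_finRange_reverse_eq_append {P P' : Fin n → Prop} [DecidablePred P]
    [DecidablePred P'] (k : Fin n) (hP : ∀ m, P m ↔ P' m ∨ m = k) (hk : ∀ m, P' m → k < m) :
    (List.finRange n).reverse.filter (fun m => P m) =
      ((List.finRange n).reverse.filter fun m => P' m) ++ [k] := by
  refine List.Pairwise.eq_of_mem_iff (r := fun a b => b < a)
    ((List.pairwise_reverse.mpr (List.pairwise_lt_finRange n)).filter _)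
    (List.pairwise_append.mpr ⟨(List.pairwise_reverse.mpr (List.pairwise_lt_finRange n)).filter _,
      List.pairwise_singleton _ _, fun m hm m' hm' => ?_⟩) fun m => by simp [hP]
  rw [List.mem_singleton.mp hm']
  exact hk m (by simpa using hm)

/-- The entries `(i, n), (i, n - 1), …, (i, l₀ + 1)` of row `i` in the segment of column `j`. -/
def rowEntries (j : ℕ) (i : Fin n) (l₀ : ℕ) : List (Entry n) :=
  ((List.finRange n).reverse.filter fun l => l₀ ≤ l.val).map fun l => ⟨j, i, l⟩

theorem rowEntries_eq_append (j : ℕ) (i l : Fin n) :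
    rowEntries j i l.val = rowEntries j i (l.val + 1) ++ [⟨j, i, l⟩] := by
  rw [rowEntries, filter_finRange_reverse_eq_append (P' := fun m => l.val + 1 ≤ m.val) l
    (fun m => by omega) (fun m hm => hm), List.map_append, List.map_singleton, rowEntries]

theorem transfer_rowEntries_succ (lam : Fin n → ℕ) (q t : K) (j : ℕ) (i l : Fin n)
    (F : Equiv.Perm (Fin n) → K) (v : Equiv.Perm (Fin n)) :
    transfer lam q t (rowEntries j i l.val) F v =
      transfer lam q t (rowEntries j i (l.val + 1)) F v +
        exchangeCoeff (q ^ arm lam (i, j - 1)) t v i l.val (v l) *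
          transfer lam q t (rowEntries j i (l.val + 1)) F (v * Equiv.swap i l) := by
  rw [rowEntries_eq_append, transfer_append]
  rfl

/-- Foldings in row `i` only move values from rows `≥ l₀` into row `i`. -/
theorem transfer_rowEntries {q t : K} {j : ℕ} {i : Fin n}
    (hQ : ∀ d : ℕ, 1 ≤ d → 1 - q ^ arm lam (i, j - 1) * t ^ d ≠ 0)
    {A : Set (Equiv.Perm (Fin n))} {F : Equiv.Perm (Fin n) → K} {C : K} {b : Fin n}
    (hF : ∀ v ∈ A, F v = if v i = b then C else 0) {l₀ : ℕ} (hil : i.val < l₀) (hln : l₀ ≤ n)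
    (hA : ∀ v ∈ A, ∀ l : Fin n, l₀ ≤ l.val → v * Equiv.swap i l ∈ A)
    {v : Equiv.Perm (Fin n)} (hv : v ∈ A) {m : Fin n} (hm : v m = b) :
    transfer lam q t (rowEntries j i l₀) F v =
      if m = i ∨ l₀ ≤ m.val then C * exchangeCoeff (q ^ arm lam (i, j - 1)) t v i l₀ b else 0 := by
  induction hln using Nat.decreasingInduction generalizing v m with
  | self =>
    have hnil : rowEntries j i n = [] := by simp [rowEntries]
    have hiff : m = i ∨ n ≤ m.val ↔ v i = b := by
      rw [← hm, v.injective.eq_iff, eq_comm]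
      exact or_iff_left m.isLt.not_ge
    rw [hnil, if_congr hiff rfl rfl]
    refine (hF v hv).trans (ite_congr rfl (fun h => ?_) fun _ => rfl)
    rw [← h, exchangeCoeff_self, mul_one]
  | of_succ k hk ih =>
    lift k to Fin n using hk with l
    have hstay := ih (by omega) (fun v hv m hm => hA v hv m (by omega)) hv hm
    have hfold := ih (by omega) (fun v hv m hm => hA v hv m (by omega))
      (hA v hv l le_rfl) (m := Equiv.swap i l m) (by simpa using hm)
    rw [transfer_rowEntries_succ, hstay, hfold]
    subst hm
    rcases eq_or_ne m i with rfl | hmi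
    · rw [Equiv.swap_apply_left, if_pos (.inl rfl), if_neg (by omega), if_pos (.inl rfl),
        exchangeCoeff_self, exchangeCoeff_self, mul_zero, add_zero]
    rcases eq_or_ne m l with rfl | hml
    · have hone := exchangeCoeff_self (q ^ arm lam (i, j - 1)) t
        (v * Equiv.swap i m : Equiv.Perm (Fin n)) i (m.val + 1)
      rw [Equiv.Perm.mul_apply, Equiv.swap_apply_left] at hone
      rw [Equiv.swap_apply_right, if_neg (by omega), if_pos (.inl rfl), if_pos (.inr le_rfl), hone]
      ring
    rw [Equiv.swap_apply_of_ne_of_ne hmi hml]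
    by_cases hlm : l < m
    · rw [if_pos (.inr hlm), if_pos (.inr hlm), if_pos (.inr hlm.le),
        ← exchangeCoeff_succ_add hQ v hil hlm]
      ring
    · rw [if_neg (by omega), if_neg (by omega), if_neg (by omega), mul_zero, add_zero]

/-! ### Foldings in a segment -/

theorem exchangeCoeff_congr (Q t : K) {v v' : Fin n → Fin n} {i : Fin n} {l : ℕ}
    (hi : v i = v' i) (h : ∀ m ∈ rowsBetween i l, v m = v' m) (b : Fin n) :
    exchangeCoeff Q t v i l b = exchangeCoeff Q t v' i l b := by
  rw [exchangeCoeff, exchangeCoeff, hi, arcWeight_congr Q t h]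

/-- The rows `k, k - 1, …, i₀ + 1` of the segment of column `j`, whose row `i` consists of the pairs
`(i, n), …, (i, r + 1)`. -/
def rowsEntries (j r i₀ k : ℕ) : List (Entry n) :=
  ((List.finRange n).reverse.filter fun i => i₀ ≤ i.val ∧ i.val < k).flatMap
    fun i => rowEntries j i r

theorem map_rootRows (j k r : ℕ) :
    (rootRows n k r).map (fun β => (⟨j, β.1, β.2⟩ : Entry n)) = rowsEntries j r 0 k := by
  simp [rootRows, rowsEntries, rowEntries, List.map_flatMap, Function.comp_def]

theorem rowsEntries_eq_append (j r : ℕ) {k : ℕ} {i : Fin n} (hi : i.val < k) :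
    rowsEntries j r i.val k = rowsEntries (n := n) j r (i.val + 1) k ++ rowEntries j i r := by
  rw [rowsEntries, filter_finRange_reverse_eq_append
    (P' := fun m => i.val + 1 ≤ m.val ∧ m.val < k) i (fun m => by omega) (fun m hm => hm.1),
    List.flatMap_append, List.flatMap_singleton, rowsEntries]

theorem filter_rows_eq_insert {i : Fin n} {k : ℕ} (hi : i.val < k) :
    (Finset.univ.filter fun m : Fin n => i.val ≤ m.val ∧ m.val < k) =
      insert i (Finset.univ.filter fun m : Fin n => i.val + 1 ≤ m.val ∧ m.val < k) := by
  ext m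
  simp only [Finset.mem_filter, Finset.mem_univ, true_and, Finset.mem_insert]
  omega

theorem forall_lt_succ_iff {r : ℕ} {i : Fin n} (hir : i.val < r) {v v' : Fin n → Fin n}
    (hv : ∀ m : Fin n, m.val < r → m ≠ i → v' m = v m) (b : Fin n → Fin n) :
    (∀ m : Fin n, m.val < i.val + 1 → v' m = b m) ↔
      v' i = b i ∧ ∀ m : Fin n, m.val < i.val → v m = b m := by
  refine ⟨fun h => ⟨h i (by omega), fun m hm => ?_⟩, fun h m hm => ?_⟩
  · rw [← hv m (by omega) (by omega), h m (by omega)]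
  · rcases eq_or_ne m i with rfl | hmi
    · exact h.1
    · rw [hv m (by omega) hmi, h.2 m (by omega)]

theorem eq_or_le_of_apply_eq {k r : ℕ} {a b : Fin n → Fin n}
    (hb : ∀ m m' : Fin n, m.val < k → m'.val < k → b m = b m' → m = m')
    (hab : ∀ i m : Fin n, i.val < k → i < m → m.val < r → a m ≠ b i) {i : Fin n} (hik : i.val < k)
    {v : Fin n → Fin n} (habove : ∀ m : Fin n, m.val < i.val → v m = b m)
    (hbelow : ∀ m : Fin n, i.val ≤ m.val → m.val < r → v m = a m) {m : Fin n} (hm : v m = b i) :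
    m = i ∨ r ≤ m.val := by
  by_contra! h
  rcases lt_or_gt_of_ne h.1 with hmi | him
  · exact hmi.ne (hb m i (by omega) hik ((habove m hmi).symm.trans hm))
  · exact hab i m hik him h.2 ((hbelow m him.le h.2).symm.trans hm)

/-- Here `a` and `b` are two consecutive columns, of heights `r` and `k`: starting from the
permutations that extend `b`, foldings in row `i` replace `b i` by `a i`. -/
theorem transfer_rowsEntries {q t : K} {j k r : ℕ} (hkr : k ≤ r) (hrn : r ≤ n)
    (hQ : ∀ i : Fin n, i.val < k → ∀ d : ℕ, 1 ≤ d → 1 - q ^ arm lam (i, j - 1) * t ^ d ≠ 0)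
    {a b : Fin n → Fin n} (hb : ∀ m m' : Fin n, m.val < k → m'.val < k → b m = b m' → m = m')
    (hab : ∀ i m : Fin n, i.val < k → i < m → m.val < r → a m ≠ b i)
    {F : Equiv.Perm (Fin n) → K} {C : K}
    (hF : ∀ v : Equiv.Perm (Fin n), F v = if ∀ m : Fin n, m.val < k → v m = b m then C else 0)
    {i₀ : ℕ} (hi₀ : i₀ ≤ k) {v : Equiv.Perm (Fin n)}
    (hv : ∀ m : Fin n, i₀ ≤ m.val → m.val < r → v m = a m) :
    transfer lam q t (rowsEntries j r i₀ k) F v =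
      if ∀ m : Fin n, m.val < i₀ → v m = b m then
        C * ∏ i with i₀ ≤ i.val ∧ i.val < k, exchangeCoeff (q ^ arm lam (i, j - 1)) t a i r (b i)
      else 0 := by
  classical
  induction hi₀ using Nat.decreasingInduction generalizing v with
  | self =>
    have hnil : rowsEntries (n := n) j r k k = [] := by simp [rowsEntries]
    rw [hnil, Finset.filter_eq_empty_iff.mpr fun i _ => by omega, Finset.prod_empty, mul_one]
    exact hF v
  | of_succ i hik ih =>
    lift i to Fin n using by omega
    set A : Set (Equiv.Perm (Fin n)) := {v' | ∀ m : Fin n, m.val < r → m ≠ i → v' m = v m}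
    set P := ∏ m : Fin n with i.val + 1 ≤ m.val ∧ m.val < k,
      exchangeCoeff (q ^ arm lam (m, j - 1)) t a m r (b m)
    have hlower : ∀ v' ∈ A, transfer lam q t (rowsEntries j r (i.val + 1) k) F v' =
        if v' i = b i then if ∀ m : Fin n, m.val < i.val → v m = b m then C * P else 0 else 0 := by
      intro v' hv'
      rw [ih fun m him hmr => (hv' m hmr (by omega)).trans (hv m (by omega) hmr), ← ite_and]
      exact if_congr (forall_lt_succ_iff (by omega) hv' b) rfl rfl
    have hA : ∀ v' ∈ A, ∀ l : Fin n, r ≤ l.val → v' * Equiv.swap i l ∈ A := by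
      intro v' hv' l hl m hmr hmi
      rw [Equiv.Perm.mul_apply, Equiv.swap_apply_of_ne_of_ne hmi (by omega), hv' m hmr hmi]
    obtain ⟨m, hm⟩ := v.surjective (b i)
    rw [rowsEntries_eq_append j r hik, transfer_append,
      transfer_rowEntries (hQ i hik) hlower (by omega) hrn hA (fun _ _ _ => rfl) hm,
      filter_rows_eq_insert hik, Finset.prod_insert (by simp)]
    have hcoeff : exchangeCoeff (q ^ arm lam (i, j - 1)) t v i r (b i) =
        exchangeCoeff (q ^ arm lam (i, j - 1)) t a i r (b i) :=
      exchangeCoeff_congr _ t (hv i le_rfl (by omega)) (fun m hm => by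
        rw [mem_rowsBetween] at hm
        exact hv m hm.1.le hm.2) _
    by_cases hmatch : ∀ m : Fin n, m.val < i.val → v m = b m
    · rw [if_pos (eq_or_le_of_apply_eq hb hab hik hmatch hv hm), if_pos hmatch, if_pos hmatch,
        hcoeff]
      ring
    · rw [if_neg hmatch, if_neg hmatch, zero_mul, ite_self]

/-! ### Walks with prescribed columns -/

/-- The part of the chain in columns larger than `j`. -/
def chainAbove (lam : Fin n → ℕ) (j : ℕ) : List (Entry n) :=
  (List.range' (j + 1) (numCols lam - j)).reverse.flatMap fun j =>
    (segment lam j).map fun β => ⟨j, β.1, β.2⟩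

theorem chainAbove_of_numCols_le {j : ℕ} (hj : numCols lam ≤ j) : chainAbove lam j = [] := by
  simp [chainAbove, Nat.sub_eq_zero_of_le hj]

theorem chainAbove_eq_append (h : StrictAnti lam) {j : ℕ} (hj : 1 ≤ j) (hjN : j < numCols lam) :
    chainAbove lam j = chainAbove lam (j + 1) ++
      rowsEntries (j + 1) (conj lam j) 0 (conj lam (j + 1)) := by
  have hseg : rootRows n (conj lam (j + 1)) (conj lam j) = segment lam (j + 1) :=
    (segment_eq h (by omega)).symm
  rw [← map_rootRows, hseg, chainAbove, chainAbove,
    show numCols lam - j = (numCols lam - (j + 1)) + 1 by omega, List.range'_succ,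
    List.reverse_cons, List.flatMap_append, List.flatMap_singleton]

theorem lt_col_of_mem_chainAbove {j : ℕ} {e : Entry n} (he : e ∈ chainAbove lam j) :
    j < e.col := by
  simp only [chainAbove, List.mem_flatMap, List.mem_reverse, List.mem_range'_1,
    List.mem_map] at he
  obtain ⟨j', hj', β, -, rfl⟩ := he
  exact hj'.1

theorem col_of_mem_rowsEntries {j r i₀ k : ℕ} {e : Entry n} (he : e ∈ rowsEntries j r i₀ k) :
    e.col = j := by
  simp only [rowsEntries, rowEntries, List.mem_flatMap, List.mem_map] at he
  obtain ⟨_, -, _, -, rfl⟩ := he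
  rfl

/-- The permutation `v` restricts to column `j` of the filling `σ`. -/
def ColMatch (σ : Filling lam) (j : ℕ) (v : Equiv.Perm (Fin n)) : Prop :=
  ∀ u : {u : Fin n × ℕ // u ∈ diagram lam}, u.1.2 = j → v u.1.1 = σ u

/-- The walk from `w` with foldings at `s` produces the columns of `σ` from column `j` on. -/
def MatchesFrom (σ : Filling lam) (j : ℕ) (w : Equiv.Perm (Fin n)) (s : List (Entry n)) : Prop :=
  ∀ k, j ≤ k → ColMatch σ k (w * ((s.filter fun e => k < e.col).map entrySwap).prod)

theorem fillingMap_eq_iff (w : Equiv.Perm (Fin n)) (J : Finset (Pos lam)) (σ : Filling lam) :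
    fillingMap lam w J = σ ↔ MatchesFrom σ 1 w ((sorted J).map (entry lam)) := by
  have hword : ∀ k, piPerm w J k =
      w * ((((sorted J).map (entry lam)).filter fun e => k < e.col).map entrySwap).prod := by
    intro k
    rw [piPerm_eq, wordAbove, List.filter_map, List.map_map]
    rfl
  simp only [MatchesFrom, ColMatch, ← hword, funext_iff, fillingMap]
  constructor
  · rintro h _ - u rfl
    exact h u
  · exact fun h u => h u.1.2 (mem_diagram.mp u.2).1 u rfl

theorem matchesFrom_append {σ : Filling lam} {j : ℕ} {w : Equiv.Perm (Fin n)}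
    {s s' : List (Entry n)} (hs : ∀ e ∈ s, j + 1 < e.col) (hs' : ∀ e ∈ s', e.col = j + 1) :
    MatchesFrom σ j w (s ++ s') ↔ MatchesFrom σ (j + 1) w s ∧
      ColMatch σ j (w * (s.map entrySwap).prod * (s'.map entrySwap).prod) := by
  have hall : ((s ++ s').filter fun e => j < e.col) = s ++ s' := by
    rw [List.filter_eq_self]
    intro e he
    rcases List.mem_append.mp he with he | he
    · simpa using (Nat.lt_succ_self j).trans (hs e he)
    · simp [hs' e he]
  have hlater : ∀ k, j + 1 ≤ k →
      ((s ++ s').filter fun e => k < e.col) = s.filter fun e => k < e.col := by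
    intro k hk
    rw [List.filter_append, List.append_right_eq_self, List.filter_eq_nil_iff]
    intro e he
    simpa [hs' e he] using hk
  rw [mul_assoc, ← List.prod_append, ← List.map_append]
  constructor
  · exact fun hM => ⟨fun k hk => hlater k hk ▸ hM k (by omega), hall ▸ hM j le_rfl⟩
  · rintro ⟨hM, hC⟩ k hk
    rcases hk.eq_or_lt with rfl | hk
    · exact hall.symm ▸ hC
    · exact (hlater k hk).symm ▸ hM k hk

/-- Column `j` of a filling, extended by arbitrary values outside the diagram. -/
def column (σ : Filling lam) (j : ℕ) (i : Fin n) : Fin n :=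
  if h : (i, j) ∈ diagram lam then σ ⟨(i, j), h⟩ else i

theorem column_apply (σ : Filling lam) (u : {u : Fin n × ℕ // u ∈ diagram lam}) :
    column σ u.1.2 u.1.1 = σ u :=
  dif_pos u.2

theorem colMatch_iff (h : Antitone lam) (σ : Filling lam) {j : ℕ} (hj : 1 ≤ j)
    (v : Equiv.Perm (Fin n)) :
    ColMatch σ j v ↔ ∀ m : Fin n, m.val < conj lam j → v m = column σ j m := by
  simp only [lt_conj_iff h]
  constructor
  · intro hC m hm
    have hmem : (m, j) ∈ diagram lam := mem_diagram.mpr ⟨hj, hm⟩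
    exact (hC ⟨(m, j), hmem⟩ rfl).trans (column_apply σ ⟨(m, j), hmem⟩).symm
  · rintro hm u rfl
    rw [← column_apply σ u]
    exact hm _ (mem_diagram.mp u.2).2

theorem Nonattacking.column_ne {σ : Filling lam} (hσ : Nonattacking σ) {i m : Fin n} {j j' : ℕ}
    (hi : (i, j) ∈ diagram lam) (hm : (m, j') ∈ diagram lam) (hatt : Attack (i, j) (m, j')) :
    column σ j i ≠ column σ j' m := by
  rw [column, column, dif_pos hi, dif_pos hm]
  exact hσ ⟨_, hi⟩ ⟨_, hm⟩ hatt

/-- The total weight of the ways to pass from the entry of the cell `(i, j + 1)` to that of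
`(i, j)`. -/
noncomputable def cellCoeff (q t : K) (σ : Filling lam) (i : Fin n) (j : ℕ) : K :=
  exchangeCoeff (q ^ arm lam (i, j)) t (column σ j) i (conj lam j) (column σ (j + 1) i)

theorem one_sub_ne_zero {q t : K} (hqt : ∀ a b : ℕ, 1 ≤ a → 1 ≤ b → q ^ a * t ^ b ≠ 1)
    {i : Fin n} {j : ℕ} (hij : j < lam i) {d : ℕ} (hd : 1 ≤ d) :
    1 - q ^ arm lam (i, j) * t ^ d ≠ 0 := by
  rw [sub_ne_zero, arm_eq]
  exact (hqt _ _ (by omega) hd).symm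

open Classical in
theorem transfer_segment (h : StrictAnti lam) {q t : K}
    (hqt : ∀ a b : ℕ, 1 ≤ a → 1 ≤ b → q ^ a * t ^ b ≠ 1) {σ : Filling lam}
    (hσ : Nonattacking σ) {j : ℕ} (hj : 1 ≤ j) (C : K) {v : Equiv.Perm (Fin n)}
    (hv : ColMatch σ j v) :
    transfer lam q t (rowsEntries (j + 1) (conj lam j) 0 (conj lam (j + 1)))
      (fun v => if ColMatch σ (j + 1) v then C else 0) v =
        C * ∏ i with j + 1 ≤ lam i, cellCoeff q t σ i j := by
  have hmem : ∀ {i : Fin n} {j : ℕ}, 1 ≤ j → i.val < conj lam j → (i, j) ∈ diagram lam :=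
    fun hj hi => mem_diagram.mpr ⟨hj, (lt_conj_iff h.antitone).1 hi⟩
  rw [transfer_rowsEntries (a := column σ j) (b := column σ (j + 1)) (C := C)
    (conj_anti lam j.le_succ) (conj_le lam j) ?_ ?_ ?_ ?_ (Nat.zero_le _) ?_,
    if_pos fun m hm => absurd hm m.val.not_lt_zero]
  · simp only [Nat.zero_le, true_and, lt_conj_iff h.antitone, cellCoeff, Nat.add_sub_cancel]
  · intro i hi d hd
    exact one_sub_ne_zero hqt ((lt_conj_iff h.antitone).1 hi) hd
  · intro m m' hm hm'
    contrapose
    exact fun hne => hσ.column_ne (hmem (by omega) hm) (hmem (by omega) hm') (.inl ⟨rfl, hne⟩)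
  · intro i m hi him hm
    exact hσ.column_ne (hmem hj hm) (hmem (by omega) hi) (.inr (.inr ⟨rfl, him⟩))
  · exact fun v => if_congr (colMatch_iff h.antitone σ (by omega) v) rfl rfl
  · exact fun m _ => (colMatch_iff h.antitone σ hj v).1 hv m

open Classical in
theorem sum_matching_walks_eq (h : StrictAnti lam) (q t : K) (σ : Filling lam) {j : ℕ}
    (hj : 1 ≤ j) (hjN : j < numCols lam) (w : Equiv.Perm (Fin n))
    (G : Equiv.Perm (Fin n) → K) :
    ((chainAbove lam j).sublists'.map fun s => if MatchesFrom σ j w s then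
      walkCoeff lam q t w s * G (w * (s.map entrySwap).prod) else 0).sum =
    ((chainAbove lam (j + 1)).sublists'.map fun s => if MatchesFrom σ (j + 1) w s then
      walkCoeff lam q t w s * ((rowsEntries (j + 1) (conj lam j) 0 (conj lam (j + 1))).sublists'.map
        fun s' => walkCoeff lam q t (w * (s.map entrySwap).prod) s' *
          if ColMatch σ j (w * (s.map entrySwap).prod * (s'.map entrySwap).prod) then
            G (w * (s.map entrySwap).prod * (s'.map entrySwap).prod) else 0).sum else 0).sum := by
  rw [chainAbove_eq_append h hj hjN, sum_sublists'_append]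
  refine congrArg List.sum (List.map_congr_left fun s hs => ?_)
  have hsplit := fun s'
      (hs' : s' ∈ (rowsEntries (j + 1) (conj lam j) 0 (conj lam (j + 1))).sublists') =>
    matchesFrom_append (σ := σ) (w := w) (s := s) (s' := s')
      (fun e he => lt_col_of_mem_chainAbove ((List.mem_sublists'.mp hs).subset he))
      fun e he => col_of_mem_rowsEntries ((List.mem_sublists'.mp hs').subset he)
  by_cases hM : MatchesFrom σ (j + 1) w s
  · rw [if_pos hM, ← List.sum_map_mul_left]
    refine congrArg List.sum (List.map_congr_left fun s' hs' => ?_)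
    simp only [hsplit s' hs', hM, true_and, walkCoeff_append, List.map_append, List.prod_append,
      ← mul_assoc, mul_ite, mul_zero]
  · rw [if_neg hM]
    refine List.sum_eq_zero fun x hx => ?_
    obtain ⟨s', hs', rfl⟩ := List.mem_map.mp hx
    rw [if_neg fun h => hM ((hsplit s' hs').1 h).1]

open Classical in
theorem sum_matching_walks (h : StrictAnti lam) {q t : K}
    (hqt : ∀ a b : ℕ, 1 ≤ a → 1 ≤ b → q ^ a * t ^ b ≠ 1) {σ : Filling lam}
    (hσ : Nonattacking σ) {j : ℕ} (hj : 1 ≤ j) (G : Equiv.Perm (Fin n) → K) :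
    ∑ w, ((chainAbove lam j).sublists'.map fun s =>
      if MatchesFrom σ j w s then
        walkCoeff lam q t w s * G (w * (s.map entrySwap).prod) else 0).sum =
    ∑ v, (if ColMatch σ j v then
      ∏ k ∈ Finset.Ico j (numCols lam), ∏ i with k + 1 ≤ lam i, cellCoeff q t σ i k else 0) *
        G v := by
  induction hd : numCols lam - j generalizing j G with
  | zero =>
    have hjN : numCols lam ≤ j := by omega
    have hlast : ∀ w, MatchesFrom σ j w [] ↔ ColMatch σ j w := fun w => by
      refine ⟨fun hM => by simpa using hM j le_rfl, fun hC k hk u hu => ?_⟩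
      have := (mem_diagram.mp u.2).2.trans (le_numCols lam u.1.1)
      simpa using hC u (by omega)
    simp [chainAbove_of_numCols_le hjN, Finset.Ico_eq_empty_of_le hjN, hlast, walkCoeff]
  | succ d ih =>
    have hjN : j < numCols lam := by omega
    simp only [sum_matching_walks_eq h q t σ hj hjN]
    rw [ih (by omega) (fun v =>
        ((rowsEntries (j + 1) (conj lam j) 0 (conj lam (j + 1))).sublists'.map fun s' =>
          walkCoeff lam q t v s' * if ColMatch σ j (v * (s'.map entrySwap).prod) then
            G (v * (s'.map entrySwap).prod) else 0).sum) (by omega),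
      sum_walkCoeff lam q t _ _ fun v => if ColMatch σ j v then G v else 0]
    refine Finset.sum_congr rfl fun v _ => ?_
    by_cases hv : ColMatch σ j v
    · rw [transfer_segment h hqt hσ hj _ hv, if_pos hv, if_pos hv,
        Finset.prod_eq_prod_Ico_succ_bot hjN, mul_comm (∏ i with _, _)]
    · rw [if_neg hv, if_neg hv, mul_zero, zero_mul]

theorem exists_colMatch_one (h : Antitone lam) {σ : Filling lam} (hσ : Nonattacking σ) :
    ∃ v : Equiv.Perm (Fin n), ColMatch σ 1 v := by
  have hinj : Function.Injective fun m : {m : Fin n // m.val < conj lam 1} => column σ 1 m.1 := by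
    intro m m'
    contrapose!
    exact fun hne => hσ.column_ne (mem_diagram.mpr ⟨le_rfl, (lt_conj_iff h).1 m.2⟩)
      (mem_diagram.mpr ⟨le_rfl, (lt_conj_iff h).1 m'.2⟩) (.inl ⟨rfl, Subtype.coe_ne_coe.mpr hne⟩)
  classical
  exact ⟨(Equiv.ofInjective _ hinj).extendSubtype, (colMatch_iff h σ le_rfl _).2 fun m hm =>
    Equiv.extendSubtype_apply_of_mem _ m hm⟩

theorem ColMatch.eq_of_one (h : StrictAnti lam) {σ : Filling lam} {v v' : Equiv.Perm (Fin n)}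
    (hv : ColMatch σ 1 v) (hv' : ColMatch σ 1 v') : v = v' := by
  rw [colMatch_iff h.antitone σ le_rfl] at hv hv'
  rw [← inv_mul_eq_one, ← Equiv.Perm.card_support_le_one, Finset.card_le_one]
  have hrow : ∀ m ∈ (v⁻¹ * v').support, lam m = 0 := by
    intro m hm
    by_contra hpos
    have hlt := (lt_conj_iff h.antitone).2 (Nat.one_le_iff_ne_zero.mpr hpos)
    refine Equiv.Perm.mem_support.mp hm ?_
    rw [Equiv.Perm.mul_apply, Equiv.Perm.inv_eq_iff_eq, hv m hlt, hv' m hlt]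
  exact fun m hm m' hm' => h.injective ((hrow m hm).trans (hrow m' hm').symm)

theorem sum_fibre_eq_prod (h : StrictAnti lam) {q t : K} (ht : t ≠ 0)
    (hqt : ∀ a b : ℕ, 1 ≤ a → 1 ≤ b → q ^ a * t ^ b ≠ 1) {σ : Filling lam}
    (hσ : Nonattacking σ) : ∑ P ∈ fibre σ, weight q t P.1 P.2 =
      ∏ k ∈ Finset.Ico 1 (numCols lam), ∏ i with k + 1 ≤ lam i, cellCoeff q t σ i k := by
  classical
  obtain ⟨v₀, hv₀⟩ := exists_colMatch_one h.antitone hσ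
  rw [fibre, Finset.sum_filter, ← Finset.univ_product_univ, Finset.sum_product]
  simp only [fillingMap_eq_iff, weight_eq_walkCoeff h q ht]
  rw [Finset.sum_congr rfl fun w _ => sum_map_entry_sorted lam fun s =>
    if MatchesFrom σ 1 w s then walkCoeff lam q t w s else 0]
  have hsum := sum_matching_walks h hqt hσ le_rfl fun _ => 1
  simp only [mul_one] at hsum
  refine hsum.trans ?_
  rw [Finset.sum_eq_single v₀ (fun v _ hv => if_neg fun hm => hv (hm.eq_of_one h hv₀))
    fun hmem => absurd (Finset.mem_univ v₀) hmem, if_pos hv₀]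

/-! ### Statistics of nonattacking fillings -/

/-- The cells `(i, j)` of the diagram for which `(i, j + 1)` is in the diagram too. -/
def innerCells (lam : Fin n → ℕ) : Finset (Fin n × ℕ) :=
  (diagram lam).filter fun u => u.2 + 1 ≤ lam u.1

theorem mem_innerCells {u : Fin n × ℕ} : u ∈ innerCells lam ↔ 1 ≤ u.2 ∧ u.2 + 1 ≤ lam u.1 := by
  simp only [innerCells, Finset.mem_filter, mem_diagram]
  omega

theorem prod_innerCells (lam : Fin n → ℕ) {M : Type*} [CommMonoid M] (f : Fin n → ℕ → M) :
    ∏ u ∈ innerCells lam, f u.1 u.2 =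
      ∏ j ∈ Finset.Ico 1 (numCols lam), ∏ i with j + 1 ≤ lam i, f i j := by
  refine Finset.prod_finset_product_right' _ _ _ fun u => ?_
  have := le_numCols lam u.1
  simp only [mem_innerCells, Finset.mem_filter, Finset.mem_univ, true_and, Finset.mem_Ico]
  omega

@[to_additive]
theorem prod_filter_exists_next (σ : Filling lam) {M : Type*} [CommMonoid M]
    (R : Fin n → Fin n → Prop) [DecidableRel R]
    [DecidablePred fun u => ∃ v, v.1 = (u.1.1, u.1.2 + 1) ∧ R (σ u) (σ v)]
    (f : Fin n × ℕ → M) :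
    ∏ u with ∃ v, v.1 = (u.1.1, u.1.2 + 1) ∧ R (σ u) (σ v), f u.1 =
      ∏ u ∈ innerCells lam,
        if R (column σ u.2 u.1) (column σ (u.2 + 1) u.1) then f u else 1 := by
  rw [← Finset.prod_filter]
  refine Finset.prod_bij (fun u _ => u.1) ?_ (fun u _ u' _ => Subtype.ext) ?_ fun _ _ => rfl
  · intro u hu
    obtain ⟨v, hv, hR⟩ := (Finset.mem_filter.mp hu).2
    have hnext := mem_diagram.mp v.2
    rw [← column_apply σ u, ← column_apply σ v, hv] at hR
    rw [hv] at hnext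
    exact Finset.mem_filter.mpr ⟨mem_innerCells.mpr ⟨(mem_diagram.mp u.2).1, hnext.2⟩, hR⟩
  · intro u hu
    obtain ⟨hinner, hR⟩ := Finset.mem_filter.mp hu
    rw [mem_innerCells] at hinner
    have hu : u ∈ diagram lam := mem_diagram.mpr ⟨hinner.1, by omega⟩
    have hv : (u.1, u.2 + 1) ∈ diagram lam := mem_diagram.mpr ⟨by simp, hinner.2⟩
    rw [column_apply σ ⟨u, hu⟩, column_apply σ ⟨_, hv⟩] at hR
    exact ⟨⟨u, hu⟩, Finset.mem_filter.mpr ⟨Finset.mem_univ _, ⟨_, hv⟩, rfl, hR⟩, rfl⟩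

/-- The triples of cells `(i, j)`, `(i, j + 1)` and `(m, j)` with `i < m`, encoded as
`⟨(i, j), m⟩`. -/
def triples (lam : Fin n → ℕ) : Finset (Σ _ : Fin n × ℕ, Fin n) :=
  (innerCells lam).sigma fun u => rowsBetween u.1 (conj lam u.2)

theorem mem_triples (h : StrictAnti lam) {x : Σ _ : Fin n × ℕ, Fin n} :
    x ∈ triples lam ↔ 1 ≤ x.1.2 ∧ x.1.1 < x.2 ∧ x.1.2 ≤ lam x.2 := by
  simp only [triples, Finset.mem_sigma, mem_innerCells, mem_rowsBetween, lt_conj_iff h.antitone]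
  constructor
  · exact fun hx => ⟨hx.1.1, hx.2⟩
  · exact fun hx => ⟨⟨hx.1, hx.2.2.trans_lt (h hx.2.1)⟩, hx.2⟩

theorem card_triples (h : StrictAnti lam) : (triples lam).card = nStat lam := by
  have hcard : nStat lam =
      (Finset.univ.sigma fun m : Fin n => Finset.Iio m ×ˢ Finset.Icc 1 (lam m)).card := by
    simp only [nStat, Finset.card_sigma, Finset.card_product, Fin.card_Iio, Nat.card_Icc,
      Nat.add_sub_cancel]
  rw [hcard]
  refine Finset.card_nbij' (fun x => ⟨x.2, x.1⟩) (fun x => ⟨x.2, x.1⟩) (fun x hx => ?_)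
    (fun x hx => ?_) (fun _ _ => rfl) fun _ _ => rfl
  · obtain ⟨hj, him, hm⟩ := (mem_triples h).1 hx
    simpa using ⟨him, hj, hm⟩
  · simp only [Finset.coe_sigma, Finset.coe_univ, Set.mem_sigma_iff, Set.mem_univ, true_and,
      Finset.mem_coe, Finset.mem_product, Finset.mem_Iio, Finset.mem_Icc] at hx
    exact (mem_triples h).2 ⟨hx.2.1, hx.1, hx.2.2⟩

theorem mem_Inv {σ : Filling lam}
    {p : {u : Fin n × ℕ // u ∈ diagram lam} × {u : Fin n × ℕ // u ∈ diagram lam}} :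
    p ∈ Inv σ ↔ ((p.1.1.2 = p.2.1.2 ∧ p.1.1.1 < p.2.1.1) ∨
      (p.2.1.2 = p.1.1.2 + 1 ∧ p.2.1.1 < p.1.1.1)) ∧
      column σ p.2.1.2 p.2.1.1 < column σ p.1.1.2 p.1.1.1 := by
  classical
  refine Finset.mem_filter.trans ?_
  simp only [Finset.mem_univ, true_and, Attack, Precedes, column_apply]
  omega

theorem card_Inv_filter_same_column (h : StrictAnti lam) (σ : Filling lam) :
    ((Inv σ).filter fun p => p.1.1.2 = p.2.1.2).card =
      ((triples lam).filter fun x => column σ x.1.2 x.2 < column σ x.1.2 x.1.1).card := by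
  refine Finset.card_bij (fun p _ => ⟨p.1.1, p.2.1.1⟩) ?_ ?_ ?_
  · rintro ⟨u, v⟩ hp
    simp only [Finset.mem_filter, mem_Inv] at hp
    obtain ⟨⟨hpair, hlt⟩, hcol⟩ := hp
    have hv := (mem_diagram.mp v.2).2
    rw [← hcol] at hlt hv
    simp only [Finset.mem_filter, mem_triples h]
    exact ⟨⟨(mem_diagram.mp u.2).1, by omega, hv⟩, hlt⟩
  · rintro ⟨u, v⟩ hp ⟨u', v'⟩ hp' heq
    simp only [Finset.mem_filter] at hp hp'
    simp only [Sigma.mk.injEq, heq_eq_eq] at heq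
    refine Prod.ext (Subtype.ext heq.1) (Subtype.ext (Prod.ext heq.2 ?_))
    exact hp.2.symm.trans ((congrArg Prod.snd heq.1).trans hp'.2)
  · rintro ⟨⟨i, j⟩, m⟩ hx
    simp only [Finset.mem_filter, mem_triples h] at hx
    obtain ⟨⟨hj, him, hm⟩, hlt⟩ := hx
    have hu : (i, j) ∈ diagram lam := mem_diagram.mpr ⟨hj, hm.trans (h him).le⟩
    have hv : (m, j) ∈ diagram lam := mem_diagram.mpr ⟨hj, hm⟩
    exact ⟨(⟨_, hu⟩, ⟨_, hv⟩),
      Finset.mem_filter.mpr ⟨mem_Inv.mpr ⟨.inl ⟨rfl, him⟩, hlt⟩, rfl⟩, rfl⟩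

theorem card_Inv_filter_next_column (h : StrictAnti lam) (σ : Filling lam) :
    ((Inv σ).filter fun p => p.1.1.2 ≠ p.2.1.2).card =
      ((triples lam).filter fun x => column σ (x.1.2 + 1) x.1.1 < column σ x.1.2 x.2).card := by
  refine Finset.card_bij (fun p _ => ⟨(p.2.1.1, p.1.1.2), p.1.1.1⟩) ?_ ?_ ?_
  · rintro ⟨u, v⟩ hp
    simp only [Finset.mem_filter, mem_Inv] at hp
    obtain ⟨⟨hpair, hlt⟩, hcol⟩ := hp
    obtain ⟨hnext, hrow⟩ := hpair.resolve_left fun hsame => hcol hsame.1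
    rw [hnext] at hlt
    simp only [Finset.mem_filter, mem_triples h]
    exact ⟨⟨(mem_diagram.mp u.2).1, hrow, (mem_diagram.mp u.2).2⟩, hlt⟩
  · rintro ⟨u, v⟩ hp ⟨u', v'⟩ hp' heq
    simp only [Finset.mem_filter, mem_Inv] at hp hp'
    simp only [Sigma.mk.injEq, Prod.mk.injEq, heq_eq_eq] at heq
    exact Prod.ext (Subtype.ext (Prod.ext heq.2 heq.1.2))
      (Subtype.ext (Prod.ext heq.1.1 (by simp only; omega)))
  · rintro ⟨⟨i, j⟩, m⟩ hx
    simp only [Finset.mem_filter, mem_triples h] at hx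
    obtain ⟨⟨hj, him, hm⟩, hlt⟩ := hx
    have hu : (m, j) ∈ diagram lam := mem_diagram.mpr ⟨hj, hm⟩
    have hv : (i, j + 1) ∈ diagram lam := mem_diagram.mpr ⟨by simp, hm.trans_lt (h him)⟩
    exact ⟨(⟨_, hu⟩, ⟨_, hv⟩),
      Finset.mem_filter.mpr ⟨mem_Inv.mpr ⟨.inr ⟨rfl, him⟩, hlt⟩, j.lt_succ_self.ne⟩, rfl⟩

/-- The number of cells below `u = (i, j)` in its column whose entry lies on the open arc from
`σ(i, j)` to `σ(i, j + 1)`. -/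
noncomputable def cellArc (σ : Filling lam) (u : Fin n × ℕ) : ℕ :=
  arcCount (rowsBetween u.1 (conj lam u.2)) (column σ u.2) (column σ u.2 u.1)
    (column σ (u.2 + 1) u.1)

open Classical in
theorem sum_cellArc (σ : Filling lam) : ∑ u ∈ innerCells lam, cellArc σ u =
    ((triples lam).filter fun x => sbtw (column σ x.1.2 x.1.1) (column σ x.1.2 x.2)
      (column σ (x.1.2 + 1) x.1.1)).card := by
  rw [Finset.card_filter, triples, Finset.sum_sigma]
  refine Finset.sum_congr rfl fun u _ => ?_
  rw [cellArc, arcCount, Finset.card_filter]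

theorem sum_leg_Des (h : Antitone lam) (σ : Filling lam) : ∑ u ∈ Des σ, leg lam u.1 =
    ((triples lam).filter fun x =>
      column σ (x.1.2 + 1) x.1.1 < column σ x.1.2 x.1.1).card := by
  rw [Finset.card_filter, triples, Finset.sum_sigma, Des,
    sum_filter_exists_next σ (fun a b => b < a)]
  refine Finset.sum_congr rfl fun u hu => ?_
  rw [leg_eq h u.1 (mem_innerCells.mp hu).1]
  split_ifs <;> simp

theorem nStat_sub_inv (h : StrictAnti lam) {σ : Filling lam} (hσ : Nonattacking σ) :
    (nStat lam : ℤ) - inv σ = ((∑ u ∈ innerCells lam, cellArc σ u : ℕ) : ℤ) := by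
  classical
  have hInv : (Inv σ).card = _ := (Finset.card_filter_add_card_filter_not
    (s := Inv σ) fun p => p.1.1.2 = p.2.1.2).symm
  rw [card_Inv_filter_same_column h, card_Inv_filter_next_column h] at hInv
  rw [inv, ← Nat.cast_sum, sum_leg_Des h.antitone, sum_cellArc, hInv, ← card_triples h]
  rw [Finset.card_eq_sum_ones]
  simp only [Finset.card_filter]
  push_cast
  rw [← Finset.sum_add_distrib, ← Finset.sum_sub_distrib, ← Finset.sum_sub_distrib]
  refine Finset.sum_congr rfl fun x hx => ?_
  obtain ⟨⟨i, j⟩, m⟩ := x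
  obtain ⟨hj, him, hm⟩ := (mem_triples h).1 hx
  have hi := hm.trans_lt (h him)
  have hmem : (m, j) ∈ diagram lam := mem_diagram.mpr ⟨hj, hm⟩
  have hne : column σ j i ≠ column σ j m :=
    hσ.column_ne (mem_diagram.mpr ⟨hj, hi.le⟩) hmem (.inl ⟨rfl, him.ne⟩)
  have hne' : column σ (j + 1) i ≠ column σ j m :=
    hσ.column_ne (mem_diagram.mpr ⟨by simp, hi⟩) hmem (.inr (.inl ⟨rfl, him⟩))
  simp only [Fin.sbtw_iff]
  split_ifs <;> omega

theorem cellCoeff_eq (h : Antitone lam) (q t : K) (σ : Filling lam) {u : Fin n × ℕ}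
    (hu : u ∈ innerCells lam) : cellCoeff q t σ u.1 u.2 =
      t ^ cellArc σ u *
      (if column σ (u.2 + 1) u.1 < column σ u.2 u.1 then q ^ arm lam u else 1) *
      if column σ u.2 u.1 ≠ column σ (u.2 + 1) u.1 then
        (1 - t) / (1 - q ^ arm lam u * t ^ (leg lam u + 1)) else 1 := by
  rw [mem_innerCells] at hu
  have hrow := (lt_conj_iff h).2 (Nat.le_of_succ_le hu.2)
  have hleg : conj lam u.2 - u.1.val = leg lam u + 1 := by
    rw [leg_eq h u.1 hu.1, card_rowsBetween _ (conj_le lam u.2)]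
    omega
  rw [cellCoeff, exchangeCoeff, arcWeight, hleg, ite_not, mul_comm (t ^ _)]
  rfl

theorem prod_cellCoeff (h : StrictAnti lam) (q t : K) {σ : Filling lam} (hσ : Nonattacking σ) :
    ∏ u ∈ innerCells lam, cellCoeff q t σ u.1 u.2 =
      t ^ ((nStat lam : ℤ) - inv σ) * q ^ maj σ *
        ∏ u ∈ Diff σ, (1 - t) / (1 - q ^ arm lam u.1 * t ^ (leg lam u.1 + 1)) := by
  rw [nStat_sub_inv h hσ, zpow_natCast, ← Finset.prod_pow_eq_pow_sum, maj,
    ← Finset.prod_pow_eq_pow_sum, Des, prod_filter_exists_next σ (fun a b => b < a)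
      fun u => q ^ arm lam u, Diff, prod_filter_exists_next σ (fun a b => a ≠ b)
      fun u => (1 - t) / (1 - q ^ arm lam u * t ^ (leg lam u + 1)),
    ← Finset.prod_mul_distrib, ← Finset.prod_mul_distrib]
  exact Finset.prod_congr rfl fun u hu => cellCoeff_eq h.antitone q t σ hu

theorem sum_fibre_weight (h : StrictAnti lam) {q t : K} (ht : t ≠ 0)
    (hqt : ∀ a b : ℕ, 1 ≤ a → 1 ≤ b → q ^ a * t ^ b ≠ 1) {σ : Filling lam}
    (hσ : Nonattacking σ) : ∑ P ∈ fibre σ, weight q t P.1 P.2 =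
      t ^ ((nStat lam : ℤ) - inv σ) * q ^ maj σ *
        ∏ u ∈ Diff σ, (1 - t) / (1 - q ^ arm lam u.1 * t ^ (leg lam u.1 + 1)) := by
  rw [sum_fibre_eq_prod h ht hqt hσ, ← prod_innerCells lam (cellCoeff q t σ),
    prod_cellCoeff h q t hσ]

-- The sum of the weights over the fibre does not vanish at `q = t = 2`.
theorem fibre_nonempty (h : StrictAnti lam) {σ : Filling lam} (hσ : Nonattacking σ) :
    (fibre σ).Nonempty := by
  have hlt : ∀ a b : ℕ, 1 ≤ b → (1 : ℚ) < 2 ^ a * 2 ^ b := fun a b hb => by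
    rw [← pow_add]
    exact one_lt_pow₀ one_lt_two (by omega)
  refine Finset.nonempty_of_sum_ne_zero (f := fun P => weight (2 : ℚ) 2 P.1 P.2) ?_
  rw [sum_fibre_weight h two_ne_zero (fun a b _ hb => (hlt a b hb).ne') hσ]
  refine mul_ne_zero (mul_ne_zero (zpow_ne_zero _ two_ne_zero) (pow_ne_zero _ two_ne_zero))
    (Finset.prod_ne_zero_iff.mpr fun u _ => div_ne_zero (by norm_num) ?_)
  exact sub_ne_zero.mpr (hlt _ _ (Nat.le_add_left 1 _)).ne

end RamYip

theorem theorem3p5_general {n : ℕ} (lam : Fin n → ℕ) (hlam : StrictAnti lam)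
    {K : Type*} [Field K] (q t : K) (ht : t ≠ 0)
    (hqt : ∀ a b : ℕ, 1 ≤ a → 1 ≤ b → q ^ a * t ^ b ≠ 1)
    (σ : RamYip.Filling lam) (hσ : RamYip.Nonattacking σ) :
    (RamYip.fibre σ).Nonempty ∧
    (∀ P ∈ RamYip.fibre σ, RamYip.permAct P.1 (RamYip.mu P.2) = RamYip.content σ) ∧
    ∑ P ∈ RamYip.fibre σ, RamYip.weight q t P.1 P.2 =
      t ^ ((RamYip.nStat lam : ℤ) - RamYip.inv σ) * q ^ RamYip.maj σ *
        ∏ u ∈ RamYip.Diff σ,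
          (1 - t) / (1 - q ^ RamYip.arm lam u.1 * t ^ (RamYip.leg lam u.1 + 1)) := by
  refine ⟨RamYip.fibre_nonempty hlam hσ, fun P hP => ?_, RamYip.sum_fibre_weight hlam ht hqt hσ⟩
  rw [RamYip.permAct_mu hlam, (Finset.mem_filter.mp hP).2]

theorem theorem3p5 {n : ℕ} (lam : Fin n → ℕ) (hlam : RamYip.IsRegular lam)
    {K : Type*} [Field K] (q t : K) (ht : t ≠ 0)
    (hqt : ∀ a b : ℕ, 1 ≤ a → 1 ≤ b → q ^ a * t ^ b ≠ 1)
    (σ : RamYip.Filling lam) (hσ : RamYip.Nonattacking σ) :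
    (RamYip.fibre σ).Nonempty ∧
    (∀ P ∈ RamYip.fibre σ, RamYip.permAct P.1 (RamYip.mu P.2) = RamYip.content σ) ∧
    ∑ P ∈ RamYip.fibre σ, RamYip.weight q t P.1 P.2 =
      t ^ ((RamYip.nStat lam : ℤ) - RamYip.inv σ) * q ^ RamYip.maj σ *
        ∏ u ∈ RamYip.Diff σ,
          (1 - t) / (1 - q ^ RamYip.arm lam u.1 * t ^ (RamYip.leg lam u.1 + 1)) :=
  theorem3p5_general lam hlam.1 q t ht hqt σ hσ
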